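/- Let $X_1,X_2$ be (non-empty) Polish spaces; $\mathcal M(X)$ and $\mathcal P(X)$ denote the finite positive Borel measures and the Borel probability measures on $X$, and $\mathcal P(X_2)$ carries the weak topology. Let $C:X_1\times\mathcal P(X_2)\to(-\infty,+\infty]$ be lower semicontinuous and bounded from below, with $C(x_1,\cdot)$ convex for every $x_1\in X_1$. For $i=1,2$ let $F_i:[0,\infty)\to[0,\infty]$ be convex and lower semicontinuous with $F_i(s)<\infty$ for some $s>0$; put $(F_i)'_\infty:=\lim_{s\to\infty}F_i(s)/s$ and, for $\gamma,\mu\in\mathcal M(X_i)$ with Lebesgue decomposition $\gamma=f\mu+\gamma^\perp$, $\mathcal F_i(\gamma|\mu):=\int F_i(f)\,d\mu+(F_i)'_\infty\,\gamma^\perp(X_i)$ (with $\infty\cdot 0=0$). For $\mu_i\in\mathcal M(X_i)$ and $\boldsymbol\gamma\in\mathcal M(X_1\times X_2)$ with marginals $\gamma_1,\gamma_2$ and disintegration $(\gamma_{x_1})_{x_1\in X_1}$ with respect to $\gamma_1$, put $$\mathcal E_C(\boldsymbol\gamma|\mu_1,\mu_2):=\sum_{i=1}^2\mathcal F_i(\gamma_i|\mu_i)+\int_{X_1}C(x_1,\gamma_{x_1})\,d\gamma_1(x_1),\qquad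 \mathcal E_C(\mu_1,\mu_2):=\inf_{\boldsymbol\gamma\in\mathcal M(X_1\times X_2)}\mathcal E_C(\boldsymbol\gamma|\mu_1,\mu_2).$$ Let $\mu_i\in\mathcal M(X_i)$, $i=1,2$. Assume that the problem is feasible, i.e. $\mathcal E_C(\boldsymbol\gamma|\mu_1,\mu_2)<\infty$ for some $\boldsymbol\gamma\in\mathcal M(X_1\times X_2)$, and coercive, i.e. either $(F_1)'_\infty=(F_2)'_\infty=+\infty$, or $X_1,X_2$ are compact and $(F_1)'_\infty+(F_2)'_\infty+\inf C>0$. Let $\boldsymbol\gamma\in\mathcal M(X_1\times X_2)$ be an optimal plan, i.e. $\mathcal E_C(\boldsymbol\gamma|\mu_1,\mu_2)=\mathcal E_C(\mu_1,\mu_2)$. Then $\boldsymbol\gamma$ is $C$-monotone: there is a measurable set $\Gamma\subseteq X_1$ with $\gamma_1(X_1\setminus\Gamma)=0$ such that for all $N$, all points $x^1,\dots,x^N\in\Gamma$ and all $m_1,\dots,m_N\in\mathcal P(X_2)$ with $\sum_{i=1}^N m_i=\sum_{i=1}^N\gamma_{x^i}$, $$\sum_{i=1}^N C(x^i,\gamma_{x^i})\le\sum_{i=1}^N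 C(x^i,m_i).$$ -/

import Mathlib

open MeasureTheory ProbabilityTheory Filter
open scoped NNReal ENNReal

noncomputable section

namespace WOET

/-- Admissible entropy functions `F : [0,∞) → [0,∞]`. -/
structure IsAdmissible (F : ℝ≥0 → ℝ≥0∞) : Prop where
  convex : ConvexOn ℝ≥0 Set.univ F
  lsc : LowerSemicontinuous F
  proper : ∃ s : ℝ≥0, 0 < s ∧ F s < ∞

/-- The recession constant `F'_∞ = lim_{s → ∞} F(s) / s`. The limit exists in `[0,∞]` for every
admissible `F` (by convexity), so it coincides with the upper limit. -/
def recession (F : ℝ≥0 → ℝ≥0∞) : ℝ≥0∞ :=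
  limsup (fun s : ℝ≥0 => F s / (s : ℝ≥0∞)) atTop

/-- The entropy functional `𝓕(γ|μ) = ∫ F(f) dμ + F'_∞ γ^⊥(X)`, where `γ = f μ + γ^⊥` is the
Lebesgue decomposition of `γ` with respect to `μ`. -/
def entropy {X : Type*} [MeasurableSpace X] (F : ℝ≥0 → ℝ≥0∞) (γ μ : Measure X) : ℝ≥0∞ :=
  ∫⁻ x, F (γ.rnDeriv μ x).toNNReal ∂μ + recession F * γ.singularPart μ Set.univ

/-- The integral `∫ f⁺ dμ - ∫ f⁻ dμ` of an extended real function (used only for functions that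
are bounded from below and finite measures, so that the second term is finite). -/
def eintegral {X : Type*} [MeasurableSpace X] (f : X → EReal) (μ : Measure X) : EReal :=
  ((∫⁻ x, (f x).toENNReal ∂μ : ℝ≥0∞) : EReal) - ((∫⁻ x, (-f x).toENNReal ∂μ : ℝ≥0∞) : EReal)

section

variable {X₁ X₂ : Type*} [TopologicalSpace X₁] [PolishSpace X₁] [MeasurableSpace X₁]
  [BorelSpace X₁] [TopologicalSpace X₂] [PolishSpace X₂] [MeasurableSpace X₂] [BorelSpace X₂]

/-- Cost functions `C : X₁ × 𝓟(X₂) → (-∞,+∞]`: jointly lower semicontinuous (`𝓟(X₂)` carries the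
weak topology), bounded from below by a real number, and convex in the second variable. -/
structure IsWeakCost (C : X₁ → ProbabilityMeasure X₂ → EReal) : Prop where
  lsc : LowerSemicontinuous (fun z : X₁ × ProbabilityMeasure X₂ => C z.1 z.2)
  bddBelow : ∃ b : ℝ, ∀ x p, (b : EReal) ≤ C x p
  convex : ∀ (x : X₁) (s t : ℝ≥0), s + t = 1 → ∀ p q r : ProbabilityMeasure X₂,
    (r : Measure X₂) = s • (p : Measure X₂) + t • (q : Measure X₂) →
      C x r ≤ ((s : ℝ) : EReal) * C x p + ((t : ℝ) : EReal) * C x q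

variable [Nonempty X₂]

/-- The disintegration `(γ_x)` of a finite measure `γ` on `X₁ × X₂` with respect to its first
marginal. -/
def disint (γ : FiniteMeasure (X₁ × X₂)) (x : X₁) : ProbabilityMeasure X₂ :=
  ⟨(γ : Measure (X₁ × X₂)).condKernel x, inferInstance⟩

/-- `𝓔_C(γ|μ₁,μ₂) = 𝓕₁(γ₁|μ₁) + 𝓕₂(γ₂|μ₂) + ∫ C(x, γ_x) dγ₁(x)`. -/
def energy (F₁ F₂ : ℝ≥0 → ℝ≥0∞) (C : X₁ → ProbabilityMeasure X₂ → EReal)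
    (μ₁ : FiniteMeasure X₁) (μ₂ : FiniteMeasure X₂) (γ : FiniteMeasure (X₁ × X₂)) : EReal :=
  ((entropy F₁ (γ : Measure (X₁ × X₂)).fst μ₁ : ℝ≥0∞) : EReal)
    + ((entropy F₂ (γ : Measure (X₁ × X₂)).snd μ₂ : ℝ≥0∞) : EReal)
    + eintegral (fun x => C x (disint γ x)) (γ : Measure (X₁ × X₂)).fst

/-- The optimal value `𝓔_C(μ₁,μ₂)`. -/
def value (F₁ F₂ : ℝ≥0 → ℝ≥0∞) (C : X₁ → ProbabilityMeasure X₂ → EReal)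
    (μ₁ : FiniteMeasure X₁) (μ₂ : FiniteMeasure X₂) : EReal :=
  ⨅ γ : FiniteMeasure (X₁ × X₂), energy F₁ F₂ C μ₁ μ₂ γ

def IsFeasible (F₁ F₂ : ℝ≥0 → ℝ≥0∞) (C : X₁ → ProbabilityMeasure X₂ → EReal)
    (μ₁ : FiniteMeasure X₁) (μ₂ : FiniteMeasure X₂) : Prop :=
  ∃ γ : FiniteMeasure (X₁ × X₂), energy F₁ F₂ C μ₁ μ₂ γ < ⊤

def IsOptimalPlan (F₁ F₂ : ℝ≥0 → ℝ≥0∞) (C : X₁ → ProbabilityMeasure X₂ → EReal)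
    (μ₁ : FiniteMeasure X₁) (μ₂ : FiniteMeasure X₂) (γ : FiniteMeasure (X₁ × X₂)) : Prop :=
  energy F₁ F₂ C μ₁ μ₂ γ = value F₁ F₂ C μ₁ μ₂

/-- The coercivity conditions: both entropies are superlinear, or both spaces are compact and
`(F₁)'_∞ + (F₂)'_∞ + inf C > 0`. -/
def IsCoercive (F₁ F₂ : ℝ≥0 → ℝ≥0∞) (C : X₁ → ProbabilityMeasure X₂ → EReal) : Prop :=
  (recession F₁ = ∞ ∧ recession F₂ = ∞) ∨
    (CompactSpace X₁ ∧ CompactSpace X₂ ∧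
      0 < ((recession F₁ : ℝ≥0∞) : EReal) + ((recession F₂ : ℝ≥0∞) : EReal)
        + ⨅ (x : X₁) (p : ProbabilityMeasure X₂), C x p)

/-- `C`-monotonicity of a finite measure on `X₁ × X₂`. The disintegration is unique up to a null
set of the first marginal, which can be removed from `Γ`, so the choice of version is
immaterial. -/
def IsCMonotone (C : X₁ → ProbabilityMeasure X₂ → EReal) (γ : FiniteMeasure (X₁ × X₂)) : Prop :=
  ∃ Γ : Set X₁, MeasurableSet Γ ∧ (γ : Measure (X₁ × X₂)).fst Γᶜ = 0 ∧
    ∀ (N : ℕ) (x : Fin N → X₁), (∀ i, x i ∈ Γ) → ∀ m : Fin N → ProbabilityMeasure X₂,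
      ∑ i, (m i : Measure X₂) = ∑ i, (disint γ (x i) : Measure X₂) →
        ∑ i, C (x i) (disint γ (x i)) ≤ ∑ i, C (x i) (m i)

end

end WOET

end

/-! Fix the first marginal `μ` of `γ` and replace the disintegration by another measurable kernel
with the same second marginal. The entropies do not change and, by feasibility, are finite, so the
disintegration minimizes `∫ c(x, q x) dμ` among such kernels `q`, where `c ≥ 0` is `C` plus a
constant. Monotonicity is then the first-order condition of this linearly constrained convex
problem.

The condition is extracted in the Hilbert cube, where a probability measure is represented by its
integrals against a determining sequence of continuous functions. An exact Lagrange multiplier need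
not exist. For each `ε`, however, compactness shows that finitely many approximate constraints
already force the cost above the optimum minus `ε`, and finite-dimensional Hahn–Banach gives a
linear functional for which the optimal map `g` is an `ε`-minimizer without constraints
(`exists_linear_certificate`). Comparison with a measurable pointwise minimizer turns this into an
inequality at every point, with an error of integral at most `ε` (`exists_pointwise_certificate`).
Summed over `x i`, the linear terms cancel because the competitors have the same sum. With `ε = 2⁻ⁿ`
the errors tend to `0` almost everywhere, which yields one set for all `N` (`exists_monotone_set`).

The induced cost on the cube is lower semicontinuous only over compact families of measures, so the
argument is localized to tight families. This loses nothing: each `m i` is dominated by `∑ γ_{x i}`,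
hence inherits its tightness (`exists_monotone_set_of_optimal`). -/

namespace WOET

open Set Topology
open scoped BoundedContinuousFunction

/-! ### Measurable selection and convergence in Hilbert space -/

/-- The infimum over a compact set of a jointly lower semicontinuous function. -/
theorem lowerSemicontinuous_biInf_of_isCompact {X Y : Type*} [TopologicalSpace X]
    [TopologicalSpace Y] {H : X → Y → ℝ≥0∞} (hH : LowerSemicontinuous (Function.uncurry H))
    {K : Set Y} (hK : IsCompact K) : LowerSemicontinuous fun x => ⨅ y ∈ K, H x y := by
  intro x a ha
  obtain ⟨b, hab, hb⟩ := exists_between ha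
  have hopen : IsOpen (Function.uncurry H ⁻¹' Ioi b) := hH.isOpen_preimage b
  have hsub : ({x} : Set X) ×ˢ K ⊆ Function.uncurry H ⁻¹' Ioi b := by
    rintro ⟨x', y⟩ ⟨rfl, hy⟩
    exact hb.trans_le (iInf₂_le y hy)
  obtain ⟨U, V, hU, -, hxU, hKV, hUV⟩ := generalized_tube_lemma isCompact_singleton hK hopen hsub
  filter_upwards [hU.mem_nhds (hxU rfl)] with x' hx'
  exact hab.trans_le (le_iInf₂ fun y hy => (hUV (mk_mem_prod hx' (hKV hy))).le)

theorem exists_forall_le_of_lowerSemicontinuous {X Y : Type*} [TopologicalSpace X]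
    [TopologicalSpace Y] {H : X → Y → ℝ≥0∞} (hH : LowerSemicontinuous (Function.uncurry H))
    {K : Set Y} (hK : IsCompact K) (hne : K.Nonempty) (x : X) :
    ∃ y ∈ K, ∀ z ∈ K, H x y ≤ H x z := by
  have h : LowerSemicontinuous (H x) := hH.comp (Continuous.prodMk_right x)
  obtain ⟨y, hy, hmin⟩ := (h.lowerSemicontinuousOn K).exists_isMinOn hne hK
  exact ⟨y, hy, fun z hz => hmin hz⟩

/-- Measurable selection of minimizers of a lower semicontinuous function over a compact set. -/
theorem exists_measurable_argmin {X Y : Type*} [TopologicalSpace X] [MeasurableSpace X]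
    [OpensMeasurableSpace X] [TopologicalSpace Y] [TopologicalSpace.MetrizableSpace Y]
    [MeasurableSpace Y] [BorelSpace Y]
    {H : X → Y → ℝ≥0∞} (hH : LowerSemicontinuous (Function.uncurry H))
    {K : Set Y} (hK : IsCompact K) (hne : K.Nonempty) :
    ∃ s : X → Y, Measurable s ∧ ∀ x, s x ∈ K ∧ ∀ y ∈ K, H x (s x) ≤ H x y := by
  let := TopologicalSpace.metrizableSpaceMetric Y
  have : CompactSpace K := isCompact_iff_compactSpace.1 hK
  have : Nonempty K := hne.to_subtype
  -- `K` is a continuous image of the Cantor set, whose order inherited from `ℝ` allows a canonical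
  -- choice: the least minimizing parameter.
  obtain ⟨f₀, hf₀, hf₀s⟩ := exists_nat_bool_continuous_surjective_of_compact K
  let f : cantorSet → Y := fun t => f₀ (cantorSetHomeomorphNatToBool t)
  have hf : Continuous f := by fun_prop
  have hfK : ∀ t, f t ∈ K := fun t => (f₀ _).2
  have hfs : ∀ y ∈ K, ∃ t, f t = y := fun y hy => by
    obtain ⟨b, hb⟩ := hf₀s ⟨y, hy⟩
    exact ⟨cantorSetHomeomorphNatToBool.symm b, by simp [f, hb]⟩
  have : CompactSpace cantorSet := isCompact_iff_compactSpace.1 isCompact_cantorSet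
  let G : X → cantorSet → ℝ≥0∞ := fun x t => H x (f t)
  have hG : LowerSemicontinuous (Function.uncurry G) :=
    hH.comp (g := fun z : X × cantorSet => (z.1, f z.2)) (by fun_prop)
  have hne' : (univ : Set cantorSet).Nonempty := by
    obtain ⟨y, hy⟩ := hne
    obtain ⟨t, -⟩ := hfs y hy
    exact ⟨t, mem_univ t⟩
  have hmin : ∀ x, ∃ t, ∀ u, G x t ≤ G x u := fun x => by
    obtain ⟨t, -, ht⟩ := exists_forall_le_of_lowerSemicontinuous hG isCompact_univ hne' x
    exact ⟨t, fun u => ht u (mem_univ u)⟩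
  have hleast : ∀ x, ∃ t, IsLeast {t | ∀ u, G x t ≤ G x u} t := fun x => by
    have hcl : IsClosed {t | ∀ u, G x t ≤ G x u} := by
      simp only [ofPred_forall]
      have : LowerSemicontinuous (G x) := hG.comp (Continuous.prodMk_right x)
      exact isClosed_iInter fun u => this.isClosed_preimage (G x u)
    exact hcl.isCompact.exists_isLeast (hmin x)
  choose τ hτ using hleast
  have hτm : Measurable τ := by
    have hm : Measurable fun x => (τ x : ℝ) := by
      refine measurable_of_Iic fun a => ?_
      by_cases hemp : {t : cantorSet | (t : ℝ) ≤ a}.Nonempty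
      · have hcpt : IsCompact {t : cantorSet | (t : ℝ) ≤ a} :=
          (isClosed_le continuous_subtype_val continuous_const).isCompact
        -- The least minimizer is at most `a` exactly when the infimum over parameters `≤ a` equals
        -- the global one. Both infima are measurable in `x`.
        have heq : (fun x => (τ x : ℝ)) ⁻¹' Iic a =
            {x | (⨅ t ∈ {t : cantorSet | (t : ℝ) ≤ a}, G x t) ≤
              ⨅ t ∈ (univ : Set cantorSet), G x t} := by
          ext x
          constructor
          · intro hx
            have h1 : (⨅ t ∈ {t : cantorSet | (t : ℝ) ≤ a}, G x t) ≤ G x (τ x) :=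
              iInf₂_le (τ x) hx
            exact h1.trans (le_iInf₂ fun u _ => (hτ x).1 u)
          · intro hx
            obtain ⟨t, ht, htmin⟩ := exists_forall_le_of_lowerSemicontinuous hG hcpt hemp x
            have hle : ∀ u, G x t ≤ G x u := fun u =>
              ((le_iInf₂ htmin).trans hx).trans (iInf₂_le u (mem_univ u))
            exact (Subtype.coe_le_coe.2 ((hτ x).2 hle)).trans ht
        rw [heq]
        exact measurableSet_le (lowerSemicontinuous_biInf_of_isCompact hG hcpt).measurable
          (lowerSemicontinuous_biInf_of_isCompact hG isCompact_univ).measurable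
      · have heq : (fun x => (τ x : ℝ)) ⁻¹' Iic a = ∅ :=
          eq_empty_of_forall_notMem fun x hx => hemp ⟨τ x, hx⟩
        rw [heq]
        exact MeasurableSet.empty
    exact hm.subtype_mk
  exact ⟨fun x => f (τ x), hf.measurable.comp hτm, fun x => ⟨hfK _, fun y hy => by
    obtain ⟨t, rfl⟩ := hfs y hy
    exact (hτ x).1 t⟩⟩

/-- Points of almost minimal norm in decreasing, midpoint-convex, bounded sets form a Cauchy
sequence by the parallelogram law. This replaces weak compactness when approximate solutions are
passed to the limit. -/
theorem exists_tendsto_of_antitone_midpoint {E : Type*} [NormedAddCommGroup E]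
    [InnerProductSpace ℝ E] [CompleteSpace E] {A : ℕ → Set E} (hA : Antitone A)
    (hne : ∀ n, (A n).Nonempty)
    (hmid : ∀ n, ∀ u ∈ A n, ∀ v ∈ A n, (2⁻¹ : ℝ) • (u + v) ∈ A n)
    {R : ℝ} (hR : ∀ u ∈ A 0, ‖u‖ ≤ R) :
    ∃ (y : ℕ → E) (z : E), (∀ n, y n ∈ A n) ∧ Tendsto y atTop (𝓝 z) := by
  let a : ℕ → ℝ := fun n => sInf ((fun u => ‖u‖ ^ 2) '' A n)
  have hbdd : ∀ n, BddBelow ((fun u : E => ‖u‖ ^ 2) '' A n) := fun n =>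
    ⟨0, by rintro _ ⟨u, -, rfl⟩; positivity⟩
  have hle : ∀ n, ∀ u ∈ A n, a n ≤ ‖u‖ ^ 2 := fun n u hu =>
    csInf_le (hbdd n) (mem_image_of_mem _ hu)
  have hamono : Monotone a := fun m n hmn =>
    csInf_le_csInf (hbdd m) ((hne n).image _) (image_mono (hA hmn))
  have habdd : BddAbove (range a) := by
    refine ⟨R ^ 2, ?_⟩
    rintro _ ⟨n, rfl⟩
    obtain ⟨u, hu⟩ := hne n
    have := hR u (hA (Nat.zero_le n) hu)
    exact (hle n u hu).trans (by gcongr)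
  obtain ⟨l, hl⟩ : ∃ l, Tendsto a atTop (𝓝 l) := ⟨_, tendsto_atTop_ciSup hamono habdd⟩
  have hex : ∀ n, ∃ u ∈ A n, ‖u‖ ^ 2 < a n + 1 / ((n : ℝ) + 1) := fun n => by
    have hpos : a n < a n + 1 / ((n : ℝ) + 1) := lt_add_of_pos_right _ (by positivity)
    obtain ⟨_, ⟨u, hu, rfl⟩, h⟩ := exists_lt_of_csInf_lt ((hne n).image _) hpos
    exact ⟨u, hu, h⟩
  choose y hy hya using hex
  have hal : ∀ n, a n ≤ l := fun n => hamono.ge_of_tendsto hl n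
  have hd : ∀ n m, n ≤ m → dist (y m) (y n) ≤ √(2 * (l - a n) + 4 * (1 / ((n : ℝ) + 1))) := by
    intro n m hnm
    rw [dist_eq_norm]
    apply Real.le_sqrt_of_sq_le
    -- The midpoint of `y m` and `y n` lies in `A n`, so its squared norm is at least `a n`.
    have h1 := hle n _ (hmid n _ (hA hnm (hy m)) _ (hy n))
    rw [norm_smul, mul_pow] at h1
    have h2 := parallelogram_law_with_norm ℝ (y m) (y n)
    have h3 : 1 / ((m : ℝ) + 1) ≤ 1 / ((n : ℝ) + 1) := by gcongr
    norm_num at h1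
    nlinarith [hya n, hya m, hal m]
  refine ⟨y, ?_⟩
  have hC : CauchySeq y := by
    refine cauchySeq_of_le_tendsto_0' (fun n => √(2 * (l - a n) + 4 * (1 / ((n : ℝ) + 1))))
      (fun n m hnm => by rw [dist_comm]; exact hd n m hnm) ?_
    have h : Tendsto (fun n : ℕ => 2 * (l - a n) + 4 * (1 / ((n : ℝ) + 1))) atTop
        (𝓝 (2 * (l - l) + 4 * 0)) :=
      ((tendsto_const_nhds.sub hl).const_mul 2).add
        (tendsto_one_div_add_atTop_nhds_zero_nat.const_mul 4)
    simpa using h.sqrt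
  obtain ⟨z, hz⟩ := cauchySeq_tendsto_of_complete hC
  exact ⟨z, hy, hz⟩

/-! ### Convex optimization over maps into the Hilbert cube -/

/-- Measurable maps into the Hilbert cube `[0,1]^ℕ`. -/
structure IsCubeMap {X : Type*} [MeasurableSpace X] (p : X → ℕ → ℝ) : Prop where
  measurable : Measurable p
  mem : ∀ x, p x ∈ Icc (0 : ℕ → ℝ) 1

/-- Convexity on the Hilbert cube, uniformly in a parameter. -/
def IsCubeConvex {X : Type*} (c : X → (ℕ → ℝ) → ℝ≥0∞) : Prop :=
  ∀ x, ∀ s t : ℝ≥0, s + t = 1 → ∀ y ∈ Icc (0 : ℕ → ℝ) 1, ∀ z ∈ Icc (0 : ℕ → ℝ) 1,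
    c x ((s : ℝ) • y + (t : ℝ) • z) ≤ s * c x y + t * c x z

section

variable {X : Type*} [MeasurableSpace X]

theorem IsCubeMap.coord {p : X → ℕ → ℝ} (hp : IsCubeMap p) (j : ℕ) : Measurable fun x => p x j :=
  (measurable_pi_apply j).comp hp.measurable

theorem IsCubeMap.norm_le {p : X → ℕ → ℝ} (hp : IsCubeMap p) (x : X) (j : ℕ) : ‖p x j‖ ≤ 1 := by
  rw [Real.norm_eq_abs, abs_le]
  have h0 := (hp.mem x).1 j
  have h1 := (hp.mem x).2 j
  simp only [Pi.zero_apply, Pi.one_apply] at h0 h1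
  constructor <;> linarith

theorem IsCubeMap.integrable {p : X → ℕ → ℝ} (hp : IsCubeMap p) (μ : Measure X)
    [IsFiniteMeasure μ] (j : ℕ) : Integrable (fun x => p x j) μ :=
  Integrable.of_bound (hp.coord j).aestronglyMeasurable 1 (ae_of_all _ fun x => hp.norm_le x j)

theorem IsCubeMap.convex_comb {p q : X → ℕ → ℝ} (hp : IsCubeMap p) (hq : IsCubeMap q)
    {s t : ℝ≥0} (hst : s + t = 1) : IsCubeMap fun x => (s : ℝ) • p x + (t : ℝ) • q x where
  measurable := (hp.measurable.const_smul (s : ℝ)).add (hq.measurable.const_smul (t : ℝ))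
  mem x := convex_Icc (0 : ℕ → ℝ) 1 (hp.mem x) (hq.mem x) s.2 t.2 (by exact_mod_cast hst)

theorem IsCubeMap.integral_convex_comb {p q : X → ℕ → ℝ} (hp : IsCubeMap p) (hq : IsCubeMap q)
    (s t : ℝ≥0) (μ : Measure X) [IsFiniteMeasure μ] (j : ℕ) :
    ∫ x, ((s : ℝ) • p x + (t : ℝ) • q x) j ∂μ = s * ∫ x, p x j ∂μ + t * ∫ x, q x j ∂μ := by
  simp only [Pi.add_apply, Pi.smul_apply, smul_eq_mul]
  rw [integral_add ((hp.integrable μ j).const_mul _) ((hq.integrable μ j).const_mul _),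
    integral_const_mul, integral_const_mul]

end

section

variable {X : Type*} [TopologicalSpace X] [MeasurableSpace X] [BorelSpace X]
  {c : X → (ℕ → ℝ) → ℝ≥0∞}

theorem IsCubeMap.measurable_cost {p : X → ℕ → ℝ} (hp : IsCubeMap p)
    (hc : LowerSemicontinuous (Function.uncurry c)) : Measurable fun x => c x (p x) :=
  hc.measurable.comp (measurable_id.prodMk hp.measurable)

theorem IsCubeMap.lintegral_convex_comb_le {p q : X → ℕ → ℝ} (hp : IsCubeMap p)
    (hq : IsCubeMap q) (hc : LowerSemicontinuous (Function.uncurry c)) (hconv : IsCubeConvex c)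
    {s t : ℝ≥0} (hst : s + t = 1) (μ : Measure X) :
    ∫⁻ x, c x ((s : ℝ) • p x + (t : ℝ) • q x) ∂μ
      ≤ s * ∫⁻ x, c x (p x) ∂μ + t * ∫⁻ x, c x (q x) ∂μ := by
  rw [← lintegral_const_mul _ (hp.measurable_cost hc), ← lintegral_const_mul _
    (hq.measurable_cost hc), ← lintegral_add_left ((hp.measurable_cost hc).const_mul _)]
  exact lintegral_mono fun x => hconv x s t hst _ (hp.mem x) _ (hq.mem x)

/-- Limits of cube maps: a pointwise a.e. limit is again given by a cube map, and costs are lower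
semicontinuous along the sequence. -/
theorem exists_isCubeMap_of_ae_tendsto {p : ℕ → X → ℕ → ℝ} (hp : ∀ n, IsCubeMap (p n))
    (hc : LowerSemicontinuous (Function.uncurry c)) (μ : Measure X) [IsFiniteMeasure μ]
    (hlim : ∀ᵐ x ∂μ, ∃ l, Tendsto (fun n => p n x) atTop (𝓝 l)) :
    ∃ q : X → ℕ → ℝ, IsCubeMap q ∧
      (∀ j, Tendsto (fun n => ∫ x, p n x j ∂μ) atTop (𝓝 (∫ x, q x j ∂μ))) ∧
      ∫⁻ x, c x (q x) ∂μ ≤ liminf (fun n => ∫⁻ x, c x (p n x) ∂μ) atTop := by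
  obtain ⟨q₀, hq₀, hq₀lim⟩ :=
    measurable_limit_of_tendsto_metrizable_ae (fun n => (hp n).measurable.aemeasurable) hlim
  -- The measurable limit lies in the cube only almost everywhere; clamping puts it there
  -- everywhere.
  let q : X → ℕ → ℝ := fun x j => max 0 (min 1 (q₀ x j))
  have hq : IsCubeMap q := by
    refine ⟨measurable_pi_lambda _ fun j => ?_, fun x => ⟨fun j => le_max_left _ _, fun j => ?_⟩⟩
    · exact measurable_const.max (measurable_const.min ((measurable_pi_apply j).comp hq₀))
    · exact max_le zero_le_one (min_le_left _ _)
  have hqlim : ∀ᵐ x ∂μ, Tendsto (fun n => p n x) atTop (𝓝 (q x)) := by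
    filter_upwards [hq₀lim] with x hx
    have hmem : q₀ x ∈ Icc (0 : ℕ → ℝ) 1 :=
      isClosed_Icc.mem_of_tendsto hx (Eventually.of_forall fun n => (hp n).mem x)
    have : q x = q₀ x := by
      funext j
      have h0 := hmem.1 j
      have h1 := hmem.2 j
      simp only [Pi.zero_apply, Pi.one_apply] at h0 h1
      simp [q, h0, h1]
    rwa [this]
  refine ⟨q, hq, fun j => ?_, ?_⟩
  · refine tendsto_integral_of_dominated_convergence (fun _ => 1)
      (fun n => ((hp n).coord j).aestronglyMeasurable) (integrable_const 1)
      (fun n => ae_of_all _ fun x => (hp n).norm_le x j) ?_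
    filter_upwards [hqlim] with x hx
    exact (tendsto_pi_nhds.1 hx) j
  · refine le_trans (lintegral_mono_ae ?_) (lintegral_liminf_le fun n => (hp n).measurable_cost hc)
    filter_upwards [hqlim] with x hx
    have h : LowerSemicontinuous (c x) := hc.comp (Continuous.prodMk_right x)
    exact (h.le_liminf (q x)).trans hx.liminf_le_liminf_comp

/-- Compactness: if the constraints `∫ p = b` can be met approximately at cost at most `r`, then
they can be met exactly at cost at most `r`. -/
theorem exists_isCubeMap_of_forall_approx (hc : LowerSemicontinuous (Function.uncurry c))
    (hconv : IsCubeConvex c) (μ : Measure X) [IsFiniteMeasure μ] (b : ℕ → ℝ) (r : ℝ≥0∞)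
    (h : ∀ k : ℕ, ∃ p : X → ℕ → ℝ, IsCubeMap p ∧
      (∀ j ≤ k, |∫ x, p x j ∂μ - b j| ≤ 1 / ((k : ℝ) + 1)) ∧ ∫⁻ x, c x (p x) ∂μ ≤ r) :
    ∃ p : X → ℕ → ℝ, IsCubeMap p ∧ (∀ j, ∫ x, p x j ∂μ = b j) ∧ ∫⁻ x, c x (p x) ∂μ ≤ r := by
  -- A finite measure on `ℕ` with the null sets of the counting measure: all coordinates together
  -- form one element of `L²(m)`, and convergence `m`-almost everywhere gives convergence of every
  -- coordinate.
  let m : Measure (X × ℕ) := μ.prod (Measure.count : Measure ℕ).toFinite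
  let Good : ℕ → (X → ℕ → ℝ) → Prop := fun k p => IsCubeMap p ∧
      (∀ j ≤ k, |∫ x, p x j ∂μ - b j| ≤ 1 / ((k : ℝ) + 1)) ∧ ∫⁻ x, c x (p x) ∂μ ≤ r
  let A : ℕ → Set (Lp ℝ 2 m) := fun k => {u | ∃ p, Good k p ∧ u =ᵐ[m] fun z => p z.1 z.2}
  have hmeas : ∀ p : X → ℕ → ℝ, IsCubeMap p → Measurable fun z : X × ℕ => p z.1 z.2 :=
    fun p hp => measurable_from_prod_countable_left fun j => hp.coord j
  have hanti : Antitone A := by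
    rintro k l hkl u ⟨p, ⟨hp, hpb, hpc⟩, hu⟩
    refine ⟨p, ⟨hp, fun j hj => (hpb j (hj.trans hkl)).trans ?_, hpc⟩, hu⟩
    gcongr
  have hne : ∀ k, (A k).Nonempty := fun k => by
    obtain ⟨p, hp⟩ := h k
    have hL : MemLp (fun z : X × ℕ => p z.1 z.2) 2 m :=
      MemLp.of_bound (hmeas p hp.1).aestronglyMeasurable 1
        (ae_of_all _ fun z => hp.1.norm_le z.1 z.2)
    exact ⟨hL.toLp _, p, hp, hL.coeFn_toLp⟩
  have hmid : ∀ k, ∀ u ∈ A k, ∀ v ∈ A k, (2⁻¹ : ℝ) • (u + v) ∈ A k := by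
    rintro k u ⟨p, ⟨hp, hpb, hpc⟩, hu⟩ v ⟨q, ⟨hq, hqb, hqc⟩, hv⟩
    have hst : (2⁻¹ : ℝ≥0) + 2⁻¹ = 1 := by rw [← two_mul]; exact mul_inv_cancel₀ two_ne_zero
    refine ⟨_, ⟨hp.convex_comb hq hst, fun j hj => ?_, ?_⟩, ?_⟩
    · rw [hp.integral_convex_comb hq]
      have h1 := abs_le.1 (hpb j hj)
      have h2 := abs_le.1 (hqb j hj)
      rw [abs_le]
      push_cast
      constructor <;> linarith [h1.1, h1.2, h2.1, h2.2]
    · refine (hp.lintegral_convex_comb_le hq hc hconv hst μ).trans ?_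
      calc _ ≤ ((2⁻¹ : ℝ≥0) : ℝ≥0∞) * r + ((2⁻¹ : ℝ≥0) : ℝ≥0∞) * r := by gcongr
        _ = r := by rw [← add_mul, ← ENNReal.coe_add, hst, ENNReal.coe_one, one_mul]
    · filter_upwards [hu, hv, Lp.coeFn_smul (2⁻¹ : ℝ) (u + v), Lp.coeFn_add u v] with z h1 h2 h3 h4
      rw [h3, Pi.smul_apply, h4, Pi.add_apply, h1, h2]
      simp only [Pi.add_apply, Pi.smul_apply, smul_eq_mul]
      push_cast
      ring
  have hbd : ∃ R : ℝ, ∀ u ∈ A 0, ‖u‖ ≤ R := by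
    refine ⟨(measureUnivNNReal m : ℝ) ^ (2 : ℝ≥0∞).toReal⁻¹ * 1, ?_⟩
    rintro u ⟨p, hp, hu⟩
    refine Lp.norm_le_of_ae_bound zero_le_one ?_
    filter_upwards [hu] with z hz
    rw [hz]
    exact hp.1.norm_le z.1 z.2
  obtain ⟨R, hR⟩ := hbd
  obtain ⟨y, u, hy, hyu⟩ := exists_tendsto_of_antitone_midpoint hanti hne hmid hR
  choose p hp hyp using hy
  obtain ⟨ns, hns, hae⟩ := (tendstoInMeasure_of_tendsto_Lp hyu).exists_seq_tendsto_ae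
  have hlim : ∀ᵐ x ∂μ, ∃ l, Tendsto (fun i => p (ns i) x) atTop (𝓝 l) := by
    have h1 : ∀ᵐ z ∂m, Tendsto (fun i => p (ns i) z.1 z.2) atTop (𝓝 (u z)) := by
      filter_upwards [hae, ae_all_iff.2 hyp] with z hz hz'
      simpa only [hz'] using hz
    filter_upwards [Measure.ae_ae_of_ae_prod h1] with x hx
    rw [ae_toFinite, Measure.ae_count_iff] at hx
    exact ⟨fun j => u (x, j), tendsto_pi_nhds.2 hx⟩
  obtain ⟨q, hq, hqi, hqc⟩ := exists_isCubeMap_of_ae_tendsto (fun i => (hp (ns i)).1) hc μ hlim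
  refine ⟨q, hq, fun j => ?_, hqc.trans ?_⟩
  · refine tendsto_nhds_unique (hqi j) ?_
    rw [tendsto_iff_dist_tendsto_zero]
    refine squeeze_zero' (Eventually.of_forall fun _ => dist_nonneg) ?_
      (tendsto_one_div_add_atTop_nhds_zero_nat.comp hns.tendsto_atTop)
    filter_upwards [eventually_ge_atTop j] with i hi
    exact (hp (ns i)).2.1 j (hi.trans (hns.id_le i))
  · exact liminf_le_of_le (by isBoundedDefault) fun a ha => by
      obtain ⟨i, hi⟩ := ha.exists
      exact hi.trans (hp (ns i)).2.2

/-! ### Dual certificates and monotonicity in the cube -/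

/-- Approximate dual certificates: an optimal cube map almost minimizes the cost perturbed by a
suitable linear functional of finitely many coordinates, without any constraint. -/
theorem exists_linear_certificate (hc : LowerSemicontinuous (Function.uncurry c))
    (hconv : IsCubeConvex c) (μ : Measure X) [IsFiniteMeasure μ] {g : X → ℕ → ℝ}
    (hg : IsCubeMap g) (hfin : ∫⁻ x, c x (g x) ∂μ ≠ ∞)
    (hopt : ∀ p : X → ℕ → ℝ, IsCubeMap p → (∀ j, ∫ x, p x j ∂μ = ∫ x, g x j ∂μ) →
      ∫⁻ x, c x (g x) ∂μ ≤ ∫⁻ x, c x (p x) ∂μ) {ε : ℝ} (hε : 0 < ε) :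
    ∃ (k : ℕ) (a : Fin k → ℝ), ∀ p : X → ℕ → ℝ, IsCubeMap p → ∫⁻ x, c x (p x) ∂μ ≠ ∞ →
      (∫⁻ x, c x (g x) ∂μ).toReal + ∑ j, a j * ∫ x, g x j ∂μ - ε
        ≤ (∫⁻ x, c x (p x) ∂μ).toReal + ∑ j, a j * ∫ x, p x j ∂μ := by
  set r₀ : ℝ := (∫⁻ x, c x (g x) ∂μ).toReal with hr₀
  obtain ⟨k, hk⟩ : ∃ k : ℕ, ∀ p : X → ℕ → ℝ, IsCubeMap p →
      (∀ j ≤ k, |∫ x, p x j ∂μ - ∫ x, g x j ∂μ| ≤ 1 / ((k : ℝ) + 1)) →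
      ∫⁻ x, c x (p x) ∂μ ≠ ∞ → r₀ - ε < (∫⁻ x, c x (p x) ∂μ).toReal := by
    by_contra! hcon
    obtain ⟨p, hp, hpb, hpc⟩ := exists_isCubeMap_of_forall_approx hc hconv μ
      (fun j => ∫ x, g x j ∂μ) (ENNReal.ofReal (r₀ - ε)) fun k => by
        obtain ⟨p, hp, hpb, hpf, hpc⟩ := hcon k
        exact ⟨p, hp, hpb, by rw [← ENNReal.ofReal_toReal hpf]; exact ENNReal.ofReal_le_ofReal hpc⟩
    have h1 := (hopt p hp hpb).trans hpc
    obtain ⟨p', -, -, -, hpc'⟩ := hcon 0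
    -- `ENNReal.ofReal` truncates at `0`; nonnegativity holds because `r₀ - ε` bounds an actual
    -- cost.
    have h2 : 0 ≤ r₀ - ε := ENNReal.toReal_nonneg.trans hpc'
    rw [← ENNReal.ofReal_toReal hfin, ENNReal.ofReal_le_ofReal_iff h2] at h1
    linarith
  -- `A` collects attainable constraint values with upper bounds for the cost; `B` is the open box
  -- around the optimal constraint values, below `r₀ - ε`. The choice of `k` makes them disjoint.
  let B : Set ((Fin (k + 1) → ℝ) × ℝ) :=
    {z | (∀ j, |z.1 j - ∫ x, g x j ∂μ| < 1 / ((k : ℝ) + 1)) ∧ z.2 < r₀ - ε}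
  let A : Set ((Fin (k + 1) → ℝ) × ℝ) :=
    {z | ∃ p : X → ℕ → ℝ, IsCubeMap p ∧ ∫⁻ x, c x (p x) ∂μ ≠ ∞ ∧
      (∀ j, z.1 j = ∫ x, p x j ∂μ) ∧ (∫⁻ x, c x (p x) ∂μ).toReal ≤ z.2}
  have hBo : IsOpen B := by
    have hB : B = (⋂ j : Fin (k + 1), {z | |z.1 j - ∫ x, g x j ∂μ| < 1 / ((k : ℝ) + 1)}) ∩
        {z | z.2 < r₀ - ε} := by
      ext z
      simp [B]
    rw [hB]
    exact (isOpen_iInter_of_finite fun j => isOpen_lt (by fun_prop) continuous_const).inter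
      (isOpen_lt continuous_snd continuous_const)
  have hBc : Convex ℝ B := by
    rintro z ⟨hz, hz'⟩ w ⟨hw, hw'⟩ s t hs ht hst
    refine ⟨fun j => ?_, ?_⟩
    · have h1 := convex_ball (∫ x, g x j ∂μ) (1 / ((k : ℝ) + 1)) (x := z.1 j) (y := w.1 j)
        (by simpa [Real.dist_eq] using hz j) (by simpa [Real.dist_eq] using hw j) hs ht hst
      simpa [Real.dist_eq] using h1
    · have h1 := convex_Iio (r₀ - ε) (x := z.2) (y := w.2) hz' hw' hs ht hst
      exact h1
  have hAc : Convex ℝ A := by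
    rintro z ⟨p, hp, hpf, hpb, hpc⟩ w ⟨q, hq, hqf, hqb, hqc⟩ s t hs ht hst
    lift s to ℝ≥0 using hs
    lift t to ℝ≥0 using ht
    have hst' : s + t = 1 := by exact_mod_cast hst
    have hle := hp.lintegral_convex_comb_le hq hc hconv hst' μ
    have hft : (s : ℝ≥0∞) * ∫⁻ x, c x (p x) ∂μ + t * ∫⁻ x, c x (q x) ∂μ ≠ ∞ :=
      ENNReal.add_ne_top.2 ⟨ENNReal.mul_ne_top ENNReal.coe_ne_top hpf,
        ENNReal.mul_ne_top ENNReal.coe_ne_top hqf⟩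
    refine ⟨_, hp.convex_comb hq hst', ne_top_of_le_ne_top hft hle, fun j => ?_, ?_⟩
    · rw [hp.integral_convex_comb hq, ← hpb j, ← hqb j]
      rfl
    · refine (ENNReal.toReal_mono hft hle).trans ?_
      rw [ENNReal.toReal_add (ENNReal.mul_ne_top ENNReal.coe_ne_top hpf)
        (ENNReal.mul_ne_top ENNReal.coe_ne_top hqf), ENNReal.toReal_mul, ENNReal.toReal_mul]
      simp only [ENNReal.coe_toReal, Prod.snd_add, Prod.smul_snd, smul_eq_mul]
      gcongr
  have hdisj : Disjoint B A := by
    rw [Set.disjoint_left]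
    rintro z ⟨hz, hz'⟩ ⟨p, hp, hpf, hpb, hpc⟩
    have := hk p hp (fun j hj => by
      have h1 := hz ⟨j, by lia⟩
      rw [hpb] at h1
      exact h1.le) hpf
    linarith
  obtain ⟨f, u, hfB, hfA⟩ := geometric_hahn_banach_open hBc hBo hAc hdisj
  let θ : ℝ := f (0, 1)
  let a : Fin (k + 1) → ℝ := fun j => f (Pi.single j 1, 0)
  have hf : ∀ z : (Fin (k + 1) → ℝ) × ℝ, f z = ∑ j, a j * z.1 j + θ * z.2 := by
    intro z
    have h1 : z = ∑ j, z.1 j • ((Pi.single j 1 : Fin (k + 1) → ℝ), (0 : ℝ)) + z.2 • (0, 1) := by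
      ext i
      · simp [Prod.fst_sum, Finset.sum_apply, Pi.single_apply]
      · simp [Prod.snd_sum]
    conv_lhs => rw [h1]
    rw [map_add, map_sum, map_smul]
    simp only [map_smul, smul_eq_mul]
    rw [mul_comm z.2]
    congr 1
    exact Finset.sum_congr rfl fun j _ => mul_comm _ _
  let bg : Fin (k + 1) → ℝ := fun j => ∫ x, g x j ∂μ
  have hgA : ∀ s : ℝ, 0 ≤ s → (bg, r₀ + s) ∈ A := fun s hs =>
    ⟨g, hg, hfin, fun j => rfl, by simpa [← hr₀] using hs⟩
  have hgB : ∀ s : ℝ, s < r₀ - ε → (bg, s) ∈ B := fun s hs => by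
    refine ⟨fun j => ?_, hs⟩
    simp only [bg, sub_self, abs_zero]
    positivity
  -- The separating hyperplane is not vertical: above the same base point `bg`, `B` contains low
  -- points and `A` contains `r₀`.
  have hθ : 0 < θ := by
    have h1 := hfB _ (hgB (r₀ - ε - 1) (by linarith))
    have h2 := hfA _ (hgA 0 le_rfl)
    rw [hf] at h1 h2
    simp only at h1 h2
    by_contra! hneg
    nlinarith
  have hu : ∑ j, a j * bg j + θ * (r₀ - ε) ≤ u := by
    refine le_of_forall_pos_le_add fun δ hδ => ?_
    have h1 := hfB _ (hgB (r₀ - ε - δ / θ) (by linarith [div_pos hδ hθ]))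
    rw [hf] at h1
    have h2 : θ * (δ / θ) = δ := mul_div_cancel₀ _ hθ.ne'
    simp only at h1
    nlinarith
  refine ⟨k + 1, fun j => a j / θ, fun p hp hpf => ?_⟩
  have h1 := hfA (fun j => ∫ x, p x j ∂μ, (∫⁻ x, c x (p x) ∂μ).toReal)
    ⟨p, hp, hpf, fun j => rfl, le_rfl⟩
  rw [hf] at h1
  have h2 := hu.trans h1
  have h3 : ∀ w : Fin (k + 1) → ℝ, ∑ j, a j / θ * w j = (∑ j, a j * w j) / θ := fun w => by
    rw [Finset.sum_div]
    exact Finset.sum_congr rfl fun j _ => by ring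
  rw [h3, h3]
  have h4 : θ * (r₀ + (∑ j, a j * bg j) / θ - ε) ≤
      θ * ((∫⁻ x, c x (p x) ∂μ).toReal + (∑ j, a j * ∫ x, p x j ∂μ) / θ) := by
    have e1 : ∀ w : ℝ, θ * (w / θ) = w := fun w => mul_div_cancel₀ _ hθ.ne'
    rw [mul_add, mul_sub, mul_add, e1, e1]
    simp only at h2
    linarith
  exact le_of_mul_le_mul_left h4 hθ

end

section

variable {X : Type*} [TopologicalSpace X] [MeasurableSpace X] [BorelSpace X]
  {c : X → (ℕ → ℝ) → ℝ≥0∞}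

/-- Pointwise form of the approximate dual certificates, with a small integrable error. -/
theorem exists_pointwise_certificate (hc : LowerSemicontinuous (Function.uncurry c))
    (hconv : IsCubeConvex c) (μ : Measure X) [IsFiniteMeasure μ] {g : X → ℕ → ℝ}
    (hg : IsCubeMap g) (hfin : ∫⁻ x, c x (g x) ∂μ ≠ ∞)
    (hopt : ∀ p : X → ℕ → ℝ, IsCubeMap p → (∀ j, ∫ x, p x j ∂μ = ∫ x, g x j ∂μ) →
      ∫⁻ x, c x (g x) ∂μ ≤ ∫⁻ x, c x (p x) ∂μ) {ε : ℝ} (hε : 0 < ε) :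
    ∃ (k : ℕ) (a : Fin k → ℝ) (M : ℝ) (h : X → ℝ≥0∞), Measurable h ∧
      ∫⁻ x, h x ∂μ ≤ ENNReal.ofReal ε ∧
      -- The shift `M` makes the affine term nonnegative on the cube, so `ENNReal.ofReal` does not
      -- truncate it.
      (∀ y ∈ Icc (0 : ℕ → ℝ) 1, 0 ≤ ∑ j, a j * y j + M) ∧
      ∀ x, ∀ y ∈ Icc (0 : ℕ → ℝ) 1, c x (g x) + ENNReal.ofReal (∑ j, a j * g x j + M)
        ≤ c x y + ENNReal.ofReal (∑ j, a j * y j + M) + h x := by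
  obtain ⟨k, a, hka⟩ := exists_linear_certificate hc hconv μ hg hfin hopt hε
  let M : ℝ := ∑ j, |a j|
  have hM : ∀ y ∈ Icc (0 : ℕ → ℝ) 1, 0 ≤ ∑ j, a j * y j + M := by
    intro y hy
    rw [← Finset.sum_add_distrib]
    refine Finset.sum_nonneg fun j _ => ?_
    have h0 := hy.1 j
    have h1 := hy.2 j
    simp only [Pi.zero_apply, Pi.one_apply] at h0 h1
    nlinarith [neg_abs_le (a j), abs_nonneg (a j)]
  let G : X → (ℕ → ℝ) → ℝ≥0∞ := fun x y => c x y + ENNReal.ofReal (∑ j, a j * y j + M)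
  have hG : LowerSemicontinuous (Function.uncurry G) := by
    have h2 : Continuous fun z : X × (ℕ → ℝ) => ENNReal.ofReal (∑ j, a j * z.2 j + M) :=
      ENNReal.continuous_ofReal.comp (by fun_prop)
    exact hc.add h2.lowerSemicontinuous
  obtain ⟨s, hsm, hs⟩ := exists_measurable_argmin hG
    (isCompact_Icc (a := (0 : ℕ → ℝ)) (b := 1)) ⟨0, le_rfl, zero_le_one⟩
  have hsc : IsCubeMap s := ⟨hsm, fun x => (hs x).1⟩
  have hint : ∀ p : X → ℕ → ℝ, IsCubeMap p → ∫⁻ x, G x (p x) ∂μ = ∫⁻ x, c x (p x) ∂μ +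
      ENNReal.ofReal (∑ j, a j * ∫ x, p x j ∂μ + M * μ.real univ) := by
    intro p hp
    have hi : ∀ j ∈ (Finset.univ : Finset (Fin k)), Integrable (fun x => a j * p x j) μ :=
      fun j _ => (hp.integrable μ j).const_mul _
    have h1 : ∫ x, (∑ j, a j * p x j + M) ∂μ = ∑ j, a j * ∫ x, p x j ∂μ + M * μ.real univ := by
      rw [integral_add (integrable_finsetSum _ hi) (integrable_const _), integral_finsetSum _ hi,
        integral_const, smul_eq_mul, mul_comm M]
      simp only [integral_const_mul]
    have hi' : Integrable (fun x => ∑ j, a j * p x j + M) μ :=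
      (integrable_finsetSum _ hi).add (integrable_const _)
    rw [← h1, ofReal_integral_eq_lintegral_ofReal hi'
      (ae_of_all _ fun x => hM _ (hp.mem x)), ← lintegral_add_left (hp.measurable_cost hc)]
  have hnn : ∀ p : X → ℕ → ℝ, IsCubeMap p →
      0 ≤ ∑ j, a j * ∫ x, p x j ∂μ + M * μ.real univ := by
    intro p hp
    rw [Finset.sum_mul, ← Finset.sum_add_distrib]
    refine Finset.sum_nonneg fun j _ => ?_
    have h0 : 0 ≤ ∫ x, p x j ∂μ := integral_nonneg fun x => (hp.mem x).1 j
    have h1 : ∫ x, p x j ∂μ ≤ μ.real univ := by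
      have := integral_mono (hp.integrable μ j) (integrable_const (1 : ℝ))
        fun x => (hp.mem x).2 j
      simpa using this
    nlinarith [neg_abs_le (a j), abs_nonneg (a j),
      mul_nonneg (sub_nonneg.2 h1) (abs_nonneg (a j))]
  have hgf : ∫⁻ x, G x (g x) ∂μ ≠ ∞ := by
    rw [hint g hg]
    exact ENNReal.add_ne_top.2 ⟨hfin, ENNReal.ofReal_ne_top⟩
  have hle : ∀ x, G x (s x) ≤ G x (g x) := fun x => (hs x).2 _ (hg.mem x)
  have hsf : ∫⁻ x, G x (s x) ∂μ ≠ ∞ := ne_top_of_le_ne_top hgf (lintegral_mono hle)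
  have hsf' : ∫⁻ x, c x (s x) ∂μ ≠ ∞ := by
    rw [hint s hsc] at hsf
    exact (ENNReal.add_ne_top.1 hsf).1
  -- The error is the gap between the perturbed cost of `g` and its pointwise minimum; the
  -- certificate applied to the selection `s` bounds its integral.
  refine ⟨k, a, M, fun x => G x (g x) - G x (s x),
    (hg.measurable_cost hG).sub (hsc.measurable_cost hG), ?_, hM, fun x y hy => ?_⟩
  · rw [lintegral_sub (hsc.measurable_cost hG) hsf (ae_of_all _ hle), tsub_le_iff_right,
      hint g hg, hint s hsc]
    rw [← ENNReal.ofReal_toReal hfin, ← ENNReal.ofReal_toReal hsf',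
      ← ENNReal.ofReal_add ENNReal.toReal_nonneg (hnn g hg),
      ← ENNReal.ofReal_add ENNReal.toReal_nonneg (hnn s hsc),
      ← ENNReal.ofReal_add hε.le (add_nonneg ENNReal.toReal_nonneg (hnn s hsc))]
    refine ENNReal.ofReal_le_ofReal ?_
    linarith [hka s hsc hsf']
  · have h1 : G x (g x) ≤ G x (s x) + (G x (g x) - G x (s x)) := le_add_tsub
    refine h1.trans ?_
    gcongr
    exact (hs x).2 y hy

/-- Optimal cube maps are monotone. -/
theorem exists_monotone_set (hc : LowerSemicontinuous (Function.uncurry c))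
    (hconv : IsCubeConvex c) (μ : Measure X) [IsFiniteMeasure μ] {g : X → ℕ → ℝ}
    (hg : IsCubeMap g) (hfin : ∫⁻ x, c x (g x) ∂μ ≠ ∞)
    (hopt : ∀ p : X → ℕ → ℝ, IsCubeMap p → (∀ j, ∫ x, p x j ∂μ = ∫ x, g x j ∂μ) →
      ∫⁻ x, c x (g x) ∂μ ≤ ∫⁻ x, c x (p x) ∂μ) :
    ∃ Γ : Set X, MeasurableSet Γ ∧ μ Γᶜ = 0 ∧ ∀ (N : ℕ) (x : Fin N → X), (∀ i, x i ∈ Γ) →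
      ∀ m : Fin N → ℕ → ℝ, (∀ i, m i ∈ Icc (0 : ℕ → ℝ) 1) → ∑ i, m i = ∑ i, g (x i) →
        ∑ i, c (x i) (g (x i)) ≤ ∑ i, c (x i) (m i) := by
  have hpos : ∀ n : ℕ, (0 : ℝ) < (1 / 2) ^ n := fun n => by positivity
  choose k a M h hhm hhi hM hh using fun n : ℕ =>
    exists_pointwise_certificate hc hconv μ hg hfin hopt (hpos n)
  have hae : ∀ᵐ x ∂μ, Tendsto (fun n => h n x) atTop (𝓝 0) := by
    have h1 : ∫⁻ x, ∑' n, h n x ∂μ ≠ ∞ := by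
      rw [lintegral_tsum fun n => (hhm n).aemeasurable]
      refine ne_top_of_le_ne_top ?_ (ENNReal.tsum_le_tsum hhi)
      rw [← ENNReal.ofReal_tsum_of_nonneg (fun n => (hpos n).le) summable_geometric_two]
      exact ENNReal.ofReal_ne_top
    filter_upwards [ae_lt_top (Measurable.tsum hhm) h1] with x hx
    exact ENNReal.tendsto_atTop_zero_of_tsum_ne_top hx.ne
  refine ⟨(toMeasurable μ {x | ¬ Tendsto (fun n => h n x) atTop (𝓝 0)})ᶜ,
    (measurableSet_toMeasurable _ _).compl, ?_, fun N x hx m hm hsum => ?_⟩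
  · rw [compl_compl, measure_toMeasurable]
    exact hae
  have hlim : ∀ i, Tendsto (fun n => h n (x i)) atTop (𝓝 0) := fun i => by
    by_contra hcon
    exact hx i (subset_toMeasurable _ _ hcon)
  have hle : ∀ n, ∑ i, c (x i) (g (x i)) ≤ ∑ i, c (x i) (m i) + ∑ i, h n (x i) := by
    intro n
    have h1 := Finset.sum_le_sum fun i (_ : i ∈ Finset.univ) => hh n (x i) (m i) (hm i)
    simp only [Finset.sum_add_distrib] at h1
    rw [← ENNReal.ofReal_sum_of_nonneg fun i _ => hM n _ (hg.mem (x i)),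
      ← ENNReal.ofReal_sum_of_nonneg fun i _ => hM n _ (hm i)] at h1
    -- Both families have the same sum, so every linear functional agrees on them.
    have h2 : ∑ i, (∑ j, a n j * g (x i) j + M n) = ∑ i, (∑ j, a n j * m i j + M n) := by
      simp only [Finset.sum_add_distrib]
      congr 1
      have hcomm : ∀ w : Fin N → ℕ → ℝ, ∑ i, ∑ j : Fin (k n), a n j * w i j =
          ∑ j : Fin (k n), ∑ i, a n j * w i j := fun w => Finset.sum_comm
      rw [hcomm m, hcomm fun i => g (x i)]
      refine Finset.sum_congr rfl fun j _ => ?_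
      rw [← Finset.mul_sum, ← Finset.mul_sum]
      have h3 := congrFun hsum j
      rw [Finset.sum_apply, Finset.sum_apply] at h3
      rw [h3]
    rw [h2, add_right_comm] at h1
    exact (ENNReal.add_le_add_iff_right ENNReal.ofReal_ne_top).1 h1
  have ht : Tendsto (fun n => ∑ i, c (x i) (m i) + ∑ i, h n (x i)) atTop
      (𝓝 (∑ i, c (x i) (m i) + ∑ _i : Fin N, 0)) :=
    tendsto_const_nhds.add (tendsto_finsetSum _ fun i _ => hlim i)
  simpa using ge_of_tendsto' ht hle

end

/-! ### Moment coordinates for probability measures -/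

section

variable {Y : Type*} [TopologicalSpace Y] [MeasurableSpace Y]

/-- A sequence of `[0,1]`-valued continuous functions whose integrals determine the values of
finite measures on a generating `π`-system, by passing to limits. -/
structure IsDetermining (f : ℕ → Y →ᵇ ℝ≥0) : Prop where
  le_one : ∀ n y, f n y ≤ 1
  exists_piSystem : ∃ S : Set (Set Y), IsPiSystem S ∧
    ‹MeasurableSpace Y› = MeasurableSpace.generateFrom S ∧
    ∀ s ∈ S, ∃ k : ℕ → ℕ, ∀ ν : Measure Y, IsFiniteMeasure ν →
      Tendsto (fun n => ∫⁻ y, f (k n) y ∂ν) atTop (𝓝 (ν s))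

/-- Complements of finite unions of basic open sets form a countable generating π-system of closed
sets, and the indicator of a closed set is a limit of continuous functions. `Nat.unpair` enumerates
all these approximations. -/
theorem exists_isDetermining [SecondCountableTopology Y] [BorelSpace Y] [HasOuterApproxClosed Y] :
    ∃ f : ℕ → Y →ᵇ ℝ≥0, IsDetermining f := by
  let b := TopologicalSpace.countableBasis Y
  let S : Set (Set Y) := (fun t : Set (Set Y) => (⋃₀ t)ᶜ) '' {t | t.Finite ∧ t ⊆ b}
  have hSc : S.Countable :=
    (Set.countable_ofPred_finite_subset (TopologicalSpace.countable_countableBasis Y)).image _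
  have hSne : S.Nonempty := ⟨_, ∅, ⟨finite_empty, empty_subset _⟩, rfl⟩
  obtain ⟨F, hF⟩ := hSc.exists_eq_range hSne
  have hclosed : ∀ i, IsClosed (F i) := fun i => by
    have : F i ∈ S := hF ▸ mem_range_self i
    obtain ⟨t, ⟨-, ht⟩, h⟩ := this
    rw [← h]
    exact (isOpen_sUnion fun u hu => TopologicalSpace.isOpen_of_mem_countableBasis
      (ht hu)).isClosed_compl
  have hpi : IsPiSystem S := by
    rintro _ ⟨t, ⟨htf, ht⟩, rfl⟩ _ ⟨u, ⟨huf, hu⟩, rfl⟩ -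
    refine ⟨t ∪ u, ⟨htf.union huf, union_subset ht hu⟩, ?_⟩
    simp only [sUnion_union, compl_union]
  have hgen : ‹MeasurableSpace Y› = MeasurableSpace.generateFrom S := by
    apply le_antisymm
    · rw [BorelSpace.measurable_eq (α := Y),
        (TopologicalSpace.isBasis_countableBasis Y).borel_eq_generateFrom]
      refine MeasurableSpace.generateFrom_le fun u hu => ?_
      rw [← compl_compl u]
      refine (MeasurableSpace.measurableSet_generateFrom ?_).compl
      exact ⟨{u}, ⟨finite_singleton u, singleton_subset_iff.2 hu⟩, by simp⟩
    · refine MeasurableSpace.generateFrom_le fun s hs => ?_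
      rw [hF] at hs
      obtain ⟨i, rfl⟩ := hs
      exact (hclosed i).measurableSet
  refine ⟨fun n => (hclosed n.unpair.1).apprSeq n.unpair.2,
    fun n y => HasOuterApproxClosed.apprSeq_apply_le_one _ _ _, S, hpi, hgen, fun s hs => ?_⟩
  rw [hF] at hs
  obtain ⟨i, rfl⟩ := hs
  refine ⟨fun n => Nat.pair i n, fun ν hν => ?_⟩
  simpa using HasOuterApproxClosed.tendsto_lintegral_apprSeq (hclosed i) ν

variable {f : ℕ → Y →ᵇ ℝ≥0}

theorem IsDetermining.measure_ext (hf : IsDetermining f) {ν₁ ν₂ : Measure Y} [IsFiniteMeasure ν₁]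
    [IsFiniteMeasure ν₂] (huniv : ν₁ univ = ν₂ univ)
    (h : ∀ n, ∫⁻ y, f n y ∂ν₁ = ∫⁻ y, f n y ∂ν₂) : ν₁ = ν₂ := by
  obtain ⟨S, hpi, hgen, hS⟩ := hf.exists_piSystem
  refine ext_of_generate_finite S hgen hpi (fun s hs => ?_) huniv
  obtain ⟨k, hk⟩ := hS s hs
  refine tendsto_nhds_unique (hk ν₁ inferInstance) ?_
  simpa only [h] using hk ν₂ inferInstance

/-- The integrals of a determining sequence against a probability measure. -/
noncomputable def moment (f : ℕ → Y →ᵇ ℝ≥0) (p : ProbabilityMeasure Y) : ℕ → ℝ :=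
  fun n => (∫⁻ y, f n y ∂(p : Measure Y)).toReal

theorem IsDetermining.lintegral_le_one (hf : IsDetermining f) (p : ProbabilityMeasure Y) (n : ℕ) :
    ∫⁻ y, f n y ∂(p : Measure Y) ≤ 1 := by
  calc ∫⁻ y, f n y ∂(p : Measure Y) ≤ ∫⁻ _, 1 ∂(p : Measure Y) :=
        lintegral_mono fun y => ENNReal.coe_le_one_iff.2 (hf.le_one n y)
    _ = 1 := by simp

theorem IsDetermining.ofReal_moment (hf : IsDetermining f) (p : ProbabilityMeasure Y) (n : ℕ) :
    ENNReal.ofReal (moment f p n) = ∫⁻ y, f n y ∂(p : Measure Y) :=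
  ENNReal.ofReal_toReal (ne_top_of_le_ne_top ENNReal.one_ne_top (hf.lintegral_le_one p n))

theorem IsDetermining.moment_mem (hf : IsDetermining f) (p : ProbabilityMeasure Y) :
    moment f p ∈ Icc (0 : ℕ → ℝ) 1 := by
  refine ⟨fun n => ENNReal.toReal_nonneg, fun n => ?_⟩
  exact ENNReal.toReal_mono ENNReal.one_ne_top (hf.lintegral_le_one p n)

theorem IsDetermining.moment_injective (hf : IsDetermining f) :
    Function.Injective (moment f : ProbabilityMeasure Y → ℕ → ℝ) := by
  intro p q h
  apply ProbabilityMeasure.toMeasure_injective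
  refine hf.measure_ext (by simp) fun n => ?_
  rw [← hf.ofReal_moment, ← hf.ofReal_moment, h]

theorem continuous_moment [OpensMeasurableSpace Y] (f : ℕ → Y →ᵇ ℝ≥0) :
    Continuous (moment f : ProbabilityMeasure Y → ℕ → ℝ) := by
  refine continuous_pi fun n => ?_
  have h := ProbabilityMeasure.continuous_testAgainstNN_eval (f n)
  exact NNReal.continuous_coe.comp h

theorem IsDetermining.sum_moment_eq (hf : IsDetermining f) {N : ℕ}
    {p q : Fin N → ProbabilityMeasure Y}
    (h : ∑ i, (p i : Measure Y) = ∑ i, (q i : Measure Y)) :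
    ∑ i, moment f (p i) = ∑ i, moment f (q i) := by
  have key : ∀ (r : Fin N → ProbabilityMeasure Y) (n : ℕ), (∑ i, moment f (r i)) n =
      (∫⁻ y, f n y ∂(∑ i, (r i : Measure Y))).toReal := fun r n => by
    rw [lintegral_finsetSum_measure, ENNReal.toReal_sum, Finset.sum_apply]
    · rfl
    · exact fun i _ => ne_top_of_le_ne_top ENNReal.one_ne_top (hf.lintegral_le_one _ n)
  funext n
  rw [key, key, h]

theorem IsDetermining.moment_convex_comb (hf : IsDetermining f) {s t : ℝ≥0}
    {p q r : ProbabilityMeasure Y}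
    (hr : (r : Measure Y) = s • (p : Measure Y) + t • (q : Measure Y)) :
    moment f r = (s : ℝ) • moment f p + (t : ℝ) • moment f q := by
  funext n
  have h1 : ∀ p : ProbabilityMeasure Y, ∫⁻ y, f n y ∂(p : Measure Y) ≠ ∞ := fun p =>
    ne_top_of_le_ne_top ENNReal.one_ne_top (hf.lintegral_le_one p n)
  simp only [moment, Pi.add_apply, Pi.smul_apply, smul_eq_mul]
  rw [hr, lintegral_add_measure, lintegral_smul_measure, lintegral_smul_measure,
    ENNReal.smul_def, ENNReal.smul_def, smul_eq_mul, smul_eq_mul,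
    ENNReal.toReal_add (ENNReal.mul_ne_top ENNReal.coe_ne_top (h1 p))
      (ENNReal.mul_ne_top ENNReal.coe_ne_top (h1 q)), ENNReal.toReal_mul, ENNReal.toReal_mul]
  rfl

variable {X : Type*} [MeasurableSpace X]

theorem IsDetermining.measurable_of_moment (hf : IsDetermining f) {q : X → ProbabilityMeasure Y}
    (h : Measurable fun x => moment f (q x)) : Measurable fun x => (q x : Measure Y) := by
  obtain ⟨S, hpi, hgen, hS⟩ := hf.exists_piSystem
  refine Measurable.measure_of_isPiSystem_of_isProbabilityMeasure hgen hpi fun s hs => ?_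
  obtain ⟨k, hk⟩ := hS s hs
  refine measurable_of_tendsto_metrizable (f := fun n x => ∫⁻ y, f (k n) y ∂(q x : Measure Y))
    (fun n => ?_) (tendsto_pi_nhds.2 fun x => hk _ inferInstance)
  simp only [← hf.ofReal_moment]
  exact ENNReal.measurable_ofReal.comp ((measurable_pi_apply (k n)).comp h)

theorem measurable_moment [OpensMeasurableSpace Y] (f : ℕ → Y →ᵇ ℝ≥0)
    {q : X → ProbabilityMeasure Y} (h : Measurable fun x => (q x : Measure Y)) :
    Measurable fun x => moment f (q x) := by
  refine measurable_pi_lambda _ fun n => ?_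
  have hm : Measurable fun y => (f n y : ℝ≥0∞) :=
    ((f n).continuous.measurable).coe_nnreal_ennreal
  exact ((Measure.measurable_lintegral hm).comp h).ennreal_toReal

end

theorem exists_convex_comb {Y : Type*} [MeasurableSpace Y] {s t : ℝ≥0} (hst : s + t = 1)
    (p q : ProbabilityMeasure Y) :
    ∃ r : ProbabilityMeasure Y, (r : Measure Y) = s • (p : Measure Y) + t • (q : Measure Y) := by
  refine ⟨⟨s • (p : Measure Y) + t • (q : Measure Y), ⟨?_⟩⟩, rfl⟩
  simp only [Measure.add_apply, Measure.smul_apply, measure_univ, ENNReal.smul_def, smul_eq_mul,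
    mul_one]
  exact_mod_cast hst

/-! ### Transfer of the cost to the cube -/

section

variable {X Y : Type*} [TopologicalSpace Y] [MeasurableSpace Y]

/-- Convexity in the second variable for costs with values in `[0,∞]`. -/
def IsConvexCost (c : X → ProbabilityMeasure Y → ℝ≥0∞) : Prop :=
  ∀ (x : X) (s t : ℝ≥0), s + t = 1 → ∀ p q r : ProbabilityMeasure Y,
    (r : Measure Y) = s • (p : Measure Y) + t • (q : Measure Y) →
      c x r ≤ s * c x p + t * c x q

/-- Convexity of a set of probability measures. -/
def IsConvexFamily (T : Set (ProbabilityMeasure Y)) : Prop :=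
  ∀ s t : ℝ≥0, s + t = 1 → ∀ p ∈ T, ∀ q ∈ T, ∀ r : ProbabilityMeasure Y,
    (r : Measure Y) = s • (p : Measure Y) + t • (q : Measure Y) → r ∈ T

/-- The cost on the Hilbert cube induced by a cost on a family `T` of probability measures. It is
infinite at the points which are not the moments of an element of `T`. -/
noncomputable def cubeCost (f : ℕ → Y →ᵇ ℝ≥0) (T : Set (ProbabilityMeasure Y))
    (c : X → ProbabilityMeasure Y → ℝ≥0∞) (x : X) (y : ℕ → ℝ) : ℝ≥0∞ :=
  ⨅ p ∈ T, (c x p + {z : ProbabilityMeasure Y × (ℕ → ℝ) | moment f z.1 ≠ z.2}.indicator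
    (fun _ => ∞) (p, y))

variable {f : ℕ → Y →ᵇ ℝ≥0} {T : Set (ProbabilityMeasure Y)} {c : X → ProbabilityMeasure Y → ℝ≥0∞}

/-- Continuity of the moments makes the mismatch set open, so its infinite penalty is lower
semicontinuous; compactness of `T` preserves this under the infimum. -/
theorem lowerSemicontinuous_cubeCost [TopologicalSpace X] [OpensMeasurableSpace Y] (hT : IsCompact T)
    (hc : LowerSemicontinuous (Function.uncurry c)) :
    LowerSemicontinuous (Function.uncurry (cubeCost f T c)) := by
  have h1 : LowerSemicontinuous fun w : (X × (ℕ → ℝ)) × ProbabilityMeasure Y => c w.1.1 w.2 :=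
    hc.comp (g := fun w : (X × (ℕ → ℝ)) × ProbabilityMeasure Y => (w.1.1, w.2)) (by fun_prop)
  have hopen : IsOpen {z : ProbabilityMeasure Y × (ℕ → ℝ) | moment f z.1 ≠ z.2} :=
    isOpen_ne_fun ((continuous_moment f).comp continuous_fst) continuous_snd
  have h2 := (hopen.lowerSemicontinuous_indicator (y := (∞ : ℝ≥0∞)) zero_le).comp
    (g := fun w : (X × (ℕ → ℝ)) × ProbabilityMeasure Y => (w.2, w.1.2)) (by fun_prop)
  exact lowerSemicontinuous_biInf_of_isCompact
    (H := fun (w : X × (ℕ → ℝ)) p => c w.1 p +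
      {z : ProbabilityMeasure Y × (ℕ → ℝ) | moment f z.1 ≠ z.2}.indicator (fun _ => ∞) (p, w.2))
    (h1.add h2) hT

theorem IsDetermining.cubeCost_moment (hf : IsDetermining f) {p : ProbabilityMeasure Y}
    (hp : p ∈ T) (x : X) : cubeCost f T c x (moment f p) = c x p := by
  apply le_antisymm
  · exact (iInf₂_le p hp).trans (by simp)
  · refine le_iInf₂ fun q hq => ?_
    by_cases h : moment f q = moment f p
    · rw [hf.moment_injective h]
      exact le_self_add
    · simp [h]

theorem exists_moment_eq_of_cubeCost_ne_top {x : X} {y : ℕ → ℝ} (h : cubeCost f T c x y ≠ ∞) :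
    ∃ p ∈ T, moment f p = y := by
  by_contra! hcon
  refine h ?_
  simp only [cubeCost, iInf_eq_top]
  intro p hp
  simp [hcon p hp]

theorem IsDetermining.isCubeConvex_cubeCost (hf : IsDetermining f) (hT : IsConvexFamily T)
    (hc : IsConvexCost c) : IsCubeConvex (cubeCost f T c) := by
  intro x s t hst y _ z _
  -- Zero weights are treated apart because `0 * ∞ = 0`; for positive weights an infinite cost makes
  -- the bound trivial.
  rcases eq_or_ne s 0 with rfl | hs
  · have ht : t = 1 := by simpa using hst
    simp [ht]
  rcases eq_or_ne t 0 with rfl | ht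
  · have hs : s = 1 := by simpa using hst
    simp [hs]
  by_cases hy : cubeCost f T c x y = ∞
  · rw [hy, ENNReal.mul_top (by exact_mod_cast hs), top_add]
    exact le_top
  by_cases hz : cubeCost f T c x z = ∞
  · rw [hz, ENNReal.mul_top (by exact_mod_cast ht), add_top]
    exact le_top
  obtain ⟨p, hp, rfl⟩ := exists_moment_eq_of_cubeCost_ne_top hy
  obtain ⟨q, hq, rfl⟩ := exists_moment_eq_of_cubeCost_ne_top hz
  obtain ⟨r, hr⟩ := exists_convex_comb hst p q
  rw [← hf.moment_convex_comb hr, hf.cubeCost_moment (hT s t hst p hp q hq r hr),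
    hf.cubeCost_moment hp, hf.cubeCost_moment hq]
  exact hc x s t hst p q r hr

end

/-! ### Kernels with values in a compact convex family -/

section

variable {X Y : Type*} [TopologicalSpace X] [MeasurableSpace X] [BorelSpace X]
  [TopologicalSpace Y] [MeasurableSpace Y] {c : X → ProbabilityMeasure Y → ℝ≥0∞}
  {f : ℕ → Y →ᵇ ℝ≥0}

theorem isFiniteMeasure_bind {X Y : Type*} [MeasurableSpace X] [MeasurableSpace Y] (μ : Measure X)
    [IsFiniteMeasure μ] {q : X → ProbabilityMeasure Y}
    (hq : Measurable fun x => (q x : Measure Y)) :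
    IsFiniteMeasure (μ.bind fun x => (q x : Measure Y)) := by
  refine ⟨?_⟩
  rw [Measure.bind_apply MeasurableSet.univ hq.aemeasurable]
  simp

/-- Monotonicity of optimal kernels over a set where the kernel takes values in a compact convex
family `T`, tested against elements of `T`. -/
theorem exists_monotone_set_of_isCompact [OpensMeasurableSpace Y] (hf : IsDetermining f)
    (hc : LowerSemicontinuous (Function.uncurry c)) (hconv : IsConvexCost c)
    (μ : Measure X) [IsFiniteMeasure μ] {q₀ : X → ProbabilityMeasure Y}
    (hq₀ : Measurable fun x => (q₀ x : Measure Y)) (hfin : ∫⁻ x, c x (q₀ x) ∂μ ≠ ∞)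
    (hopt : ∀ q : X → ProbabilityMeasure Y, Measurable (fun x => (q x : Measure Y)) →
      μ.bind (fun x => (q x : Measure Y)) = μ.bind (fun x => (q₀ x : Measure Y)) →
      ∫⁻ x, c x (q₀ x) ∂μ ≤ ∫⁻ x, c x (q x) ∂μ)
    {T : Set (ProbabilityMeasure Y)} (hT : IsCompact T) (hTc : IsConvexFamily T)
    {K : Set X} (hK : MeasurableSet K) (hKT : ∀ x ∈ K, q₀ x ∈ T) :
    ∃ Γ ⊆ K, MeasurableSet Γ ∧ μ (K \ Γ) = 0 ∧ ∀ (N : ℕ) (x : Fin N → X), (∀ i, x i ∈ Γ) →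
      ∀ m : Fin N → ProbabilityMeasure Y, (∀ i, m i ∈ T) →
        ∑ i, (m i : Measure Y) = ∑ i, (q₀ (x i) : Measure Y) →
        ∑ i, c (x i) (q₀ (x i)) ≤ ∑ i, c (x i) (m i) := by
  classical
  rcases K.eq_empty_or_nonempty with rfl | ⟨x₀, hx₀⟩
  · refine ⟨∅, subset_rfl, MeasurableSet.empty, by simp, fun N x hx m _ _ => ?_⟩
    have : IsEmpty (Fin N) := ⟨fun i => hx i⟩
    simp
  have hclosed : IsClosed (moment f '' T) := (hT.image (continuous_moment f)).isClosed
  let C := cubeCost f T c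
  have hC : LowerSemicontinuous (Function.uncurry C) := lowerSemicontinuous_cubeCost hT hc
  let g : X → ℕ → ℝ := K.piecewise (fun x => moment f (q₀ x)) fun _ => moment f (q₀ x₀)
  have hgK : ∀ x ∈ K, g x = moment f (q₀ x) := fun x hx => piecewise_eq_of_mem _ _ _ hx
  have hg : IsCubeMap g := by
    refine ⟨(measurable_moment f hq₀).piecewise hK measurable_const, fun x => ?_⟩
    by_cases hx : x ∈ K
    · rw [hgK x hx]
      exact hf.moment_mem _
    · rw [show g x = _ from piecewise_eq_of_notMem _ _ _ hx]
      exact hf.moment_mem _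
  have hCg : ∀ x ∈ K, C x (g x) = c x (q₀ x) := fun x hx => by
    rw [hgK x hx]
    exact hf.cubeCost_moment (hKT x hx) x
  have hCgi : ∫⁻ x in K, C x (g x) ∂μ = ∫⁻ x in K, c x (q₀ x) ∂μ :=
    setLIntegral_congr_fun hK hCg
  have hgfin : ∫⁻ x in K, C x (g x) ∂μ ≠ ∞ := by
    rw [hCgi]
    exact ne_top_of_le_ne_top hfin (setLIntegral_le_lintegral _ _)
  obtain ⟨Γ, hΓ, hΓ0, hmono⟩ := exists_monotone_set hC (hf.isCubeConvex_cubeCost hTc hconv)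
    (μ.restrict K) hg hgfin fun p hp hpi => by
      by_cases htop : ∫⁻ x in K, C x (p x) ∂μ = ∞
      · rw [htop]
        exact le_top
      -- A competitor of finite cost takes values in the moments of `T` almost everywhere on `K`. It
      -- is decoded to a kernel there and `q₀` is kept elsewhere; the kernel is measurable because
      -- its moments are.
      let K' : Set X := K ∩ p ⁻¹' (moment f '' T)
      have hK' : MeasurableSet K' := hK.inter (hp.measurable hclosed.measurableSet)
      have hex : ∀ x, ∃ r : ProbabilityMeasure Y,
          (x ∈ K' → r ∈ T ∧ moment f r = p x) ∧ (x ∉ K' → r = q₀ x) := fun x => by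
        by_cases hx : x ∈ K'
        · obtain ⟨r, hr, hrx⟩ := hx.2
          exact ⟨r, fun _ => ⟨hr, hrx⟩, fun h => absurd hx h⟩
        · exact ⟨q₀ x, fun h => absurd h hx, fun _ => rfl⟩
      choose q hqK hqK' using hex
      have hqm : Measurable fun x => (q x : Measure Y) := by
        refine hf.measurable_of_moment ?_
        have : (fun x => moment f (q x)) = K'.piecewise p fun x => moment f (q₀ x) := by
          funext x
          by_cases hx : x ∈ K'
          · rw [piecewise_eq_of_mem _ _ _ hx, (hqK x hx).2]
          · rw [piecewise_eq_of_notMem _ _ _ hx, hqK' x hx]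
        rw [this]
        exact hp.measurable.piecewise hK' (measurable_moment f hq₀)
      have hae : ∀ᵐ x ∂μ.restrict K, x ∈ K' := by
        filter_upwards [ae_lt_top (hp.measurable_cost hC) htop, ae_restrict_mem hK] with x hx hxK
        obtain ⟨r, hr, hrx⟩ := exists_moment_eq_of_cubeCost_ne_top hx.ne
        exact ⟨hxK, r, hr, hrx⟩
      have hcompl : ∀ x ∈ Kᶜ, q x = q₀ x := fun x hx => hqK' x fun h => hx h.1
      have hbind : μ.bind (fun x => (q x : Measure Y)) = μ.bind (fun x => (q₀ x : Measure Y)) := by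
        have := isFiniteMeasure_bind μ hqm
        have := isFiniteMeasure_bind μ hq₀
        refine hf.measure_ext ?_ fun n => ?_
        · rw [Measure.bind_apply MeasurableSet.univ hqm.aemeasurable,
            Measure.bind_apply MeasurableSet.univ hq₀.aemeasurable]
          simp
        · have hfm : Measurable fun y => (f n y : ℝ≥0∞) :=
            ((f n).continuous.measurable).coe_nnreal_ennreal
          rw [Measure.lintegral_bind hqm.aemeasurable hfm.aemeasurable,
            Measure.lintegral_bind hq₀.aemeasurable hfm.aemeasurable,
            ← lintegral_add_compl _ hK, ← lintegral_add_compl (μ := μ)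
              (fun x => ∫⁻ y, f n y ∂(q₀ x : Measure Y)) hK]
          congr 1
          · have h1 : ∫⁻ x in K, ∫⁻ y, f n y ∂(q x : Measure Y) ∂μ =
                ∫⁻ x in K, ENNReal.ofReal (p x n) ∂μ := by
              refine lintegral_congr_ae ?_
              filter_upwards [hae] with x hx
              rw [← hf.ofReal_moment, (hqK x hx).2]
            have h2 : ∫⁻ x in K, ∫⁻ y, f n y ∂(q₀ x : Measure Y) ∂μ =
                ∫⁻ x in K, ENNReal.ofReal (g x n) ∂μ := by
              refine setLIntegral_congr_fun hK fun x hx => ?_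
              simp only [hgK x hx, hf.ofReal_moment]
            rw [h1, h2, ← ofReal_integral_eq_lintegral_ofReal (hp.integrable _ n)
                (ae_of_all _ fun x => (hp.mem x).1 n),
              ← ofReal_integral_eq_lintegral_ofReal (hg.integrable _ n)
                (ae_of_all _ fun x => (hg.mem x).1 n), hpi n]
          · exact setLIntegral_congr_fun hK.compl fun x hx => by simp only [hcompl x hx]
      have hle := hopt q hqm hbind
      rw [← lintegral_add_compl _ hK, ← lintegral_add_compl (μ := μ) (fun x => c x (q x)) hK] at hle
      have h3 : ∫⁻ x in Kᶜ, c x (q x) ∂μ = ∫⁻ x in Kᶜ, c x (q₀ x) ∂μ :=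
        setLIntegral_congr_fun hK.compl fun x hx => by simp only [hcompl x hx]
      rw [h3, ENNReal.add_le_add_iff_right
        (ne_top_of_le_ne_top hfin (setLIntegral_le_lintegral _ _))] at hle
      rw [hCgi]
      refine hle.trans (lintegral_mono_ae ?_)
      filter_upwards [hae] with x hx
      obtain ⟨h4, h5⟩ := hqK x hx
      rw [← h5]
      exact (hf.cubeCost_moment h4 x).ge
  refine ⟨Γ ∩ K, inter_subset_right, hΓ.inter hK, ?_, fun N x hx m hm hsum => ?_⟩
  · rw [Measure.restrict_apply hΓ.compl] at hΓ0
    refine measure_mono_null (fun x hx => ?_) hΓ0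
    exact ⟨fun h => hx.2 ⟨h, hx.1⟩, hx.1⟩
  · have h1 := hmono N x (fun i => (hx i).1) (fun i => moment f (m i))
      (fun i => hf.moment_mem _) (by
        rw [hf.sum_moment_eq hsum]
        exact Finset.sum_congr rfl fun i _ => (hgK _ (hx i).2).symm)
    calc ∑ i, c (x i) (q₀ (x i)) = ∑ i, C (x i) (g (x i)) :=
          Finset.sum_congr rfl fun i _ => (hCg _ (hx i).2).symm
      _ ≤ ∑ i, C (x i) (moment f (m i)) := h1
      _ = ∑ i, c (x i) (m i) := Finset.sum_congr rfl fun i _ => hf.cubeCost_moment (hm i) _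

end

/-! ### Exhaustion by tight families -/

section

variable {Y : Type*} [MeasurableSpace Y]

/-- The probability measures whose mass outside of `L j` is at most `R 2⁻ʲ`. -/
def tightFamily (L : ℕ → Set Y) (R : ℝ≥0) : Set (ProbabilityMeasure Y) :=
  {p | ∀ j, p (L j)ᶜ ≤ R * (1 / 2) ^ j}

theorem mem_tightFamily {L : ℕ → Set Y} {R : ℝ≥0} {p : ProbabilityMeasure Y} :
    p ∈ tightFamily L R ↔ ∀ j, (p : Measure Y) (L j)ᶜ ≤ R * (1 / 2) ^ j := by
  refine forall_congr' fun j => ?_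
  rw [← ENNReal.coe_le_coe, ProbabilityMeasure.ennreal_coeFn_eq_coeFn_toMeasure]
  push_cast
  simp

theorem isCompact_tightFamily [TopologicalSpace Y] [T2Space Y] [NormalSpace Y] [BorelSpace Y] {L : ℕ → Set Y}
    (hL : ∀ j, IsCompact (L j)) (R : ℝ≥0) : IsCompact (tightFamily L R) := by
  refine isCompact_setOfPred_probabilityMeasure_mass_eq_compl_isCompact_le ?_ hL
    (Or.inl inferInstance)
  have h : Tendsto (fun n : ℕ => R * (1 / 2 : ℝ≥0) ^ n) atTop (𝓝 (R * 0)) :=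
    (NNReal.tendsto_pow_atTop_nhds_zero_of_lt_one
      (NNReal.half_lt_self one_ne_zero)).const_mul R
  simpa using h

theorem isConvexFamily_tightFamily (L : ℕ → Set Y) (R : ℝ≥0) :
    IsConvexFamily (tightFamily L R) := by
  intro s t hst p hp q hq r hr
  rw [mem_tightFamily] at hp hq ⊢
  intro j
  rw [hr, Measure.add_apply, Measure.smul_apply, Measure.smul_apply, ENNReal.smul_def,
    ENNReal.smul_def, smul_eq_mul, smul_eq_mul]
  calc _ ≤ (s : ℝ≥0∞) * (R * (1 / 2) ^ j) + t * (R * (1 / 2) ^ j) := by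
        gcongr
        · exact hp j
        · exact hq j
    _ = R * (1 / 2) ^ j := by
        rw [← add_mul, ← ENNReal.coe_add, hst, ENNReal.coe_one, one_mul]

variable {X : Type*} [MeasurableSpace X]

theorem measurableSet_preimage_tightFamily [TopologicalSpace Y] [BorelSpace Y] [T2Space Y]
    {L : ℕ → Set Y} (hL : ∀ j, IsCompact (L j)) (R : ℝ≥0) {q : X → ProbabilityMeasure Y}
    (hq : Measurable fun x => (q x : Measure Y)) : MeasurableSet {x | q x ∈ tightFamily L R} := by
  simp only [mem_tightFamily, ofPred_forall]
  exact MeasurableSet.iInter fun j => measurableSet_le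
    ((Measure.measurable_coe (hL j).measurableSet.compl).comp hq) measurable_const

/-- A measurable kernel takes values almost everywhere in an increasing union of tight families. -/
theorem exists_ae_mem_tightFamily [TopologicalSpace Y] [PolishSpace Y] [BorelSpace Y]
    (μ : Measure X) [IsFiniteMeasure μ] {q : X → ProbabilityMeasure Y}
    (hq : Measurable fun x => (q x : Measure Y)) :
    ∃ L : ℕ → Set Y, (∀ j, IsCompact (L j)) ∧
      ∀ᵐ x ∂μ, ∃ n₀ : ℕ, ∀ n ≥ n₀, q x ∈ tightFamily L n := by
  have := isFiniteMeasure_bind μ hq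
  have htight : IsTightMeasureSet {μ.bind fun x => (q x : Measure Y)} :=
    isTightMeasureSet_singleton
  rw [isTightMeasureSet_iff_exists_isCompact_measure_compl_le] at htight
  -- Tails of size `4⁻ʲ` leave a summable series after weighting by `2ʲ`; its sum at `x` dictates
  -- `n₀`.
  have hpos : ∀ j : ℕ, (0 : ℝ≥0∞) < (1 / 4) ^ j := fun j =>
    ENNReal.pow_pos (by simp) j
  choose L hL hLν using fun j => htight _ (hpos j)
  refine ⟨L, hL, ?_⟩
  have hm₀ : ∀ j, Measurable fun x => (q x : Measure Y) (L j)ᶜ := fun j =>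
    (Measure.measurable_coe (hL j).measurableSet.compl).comp hq
  have hm : ∀ j, Measurable fun x => 2 ^ j * (q x : Measure Y) (L j)ᶜ := fun j =>
    (hm₀ j).const_mul _
  have hfin : ∫⁻ x, ∑' j, 2 ^ j * (q x : Measure Y) (L j)ᶜ ∂μ ≠ ∞ := by
    rw [lintegral_tsum fun j => (hm j).aemeasurable]
    refine ne_top_of_le_ne_top (b := ∑' j : ℕ, (1 / 2 : ℝ≥0∞) ^ j) ?_
      (ENNReal.tsum_le_tsum fun j => ?_)
    · rw [ENNReal.tsum_geometric]
      simp
    · rw [lintegral_const_mul _ (hm₀ j),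
        ← Measure.bind_apply (hL j).measurableSet.compl hq.aemeasurable]
      calc (2 : ℝ≥0∞) ^ j * (μ.bind fun x => (q x : Measure Y)) (L j)ᶜ
          ≤ 2 ^ j * (1 / 4) ^ j := by
            gcongr
            exact hLν j _ rfl
        _ = (1 / 2) ^ j := by
            rw [← mul_pow]
            congr 1
            rw [← ENNReal.toReal_eq_toReal_iff' (by finiteness) (by finiteness)]
            norm_num
  filter_upwards [ae_lt_top (Measurable.tsum hm) hfin] with x hx
  obtain ⟨n₀, hn₀⟩ := ENNReal.exists_nat_gt hx.ne
  refine ⟨n₀, fun n hn => mem_tightFamily.2 fun j => ?_⟩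
  have h1 : 2 ^ j * (q x : Measure Y) (L j)ᶜ ≤ n :=
    ((ENNReal.le_tsum j).trans hn₀.le).trans (by exact_mod_cast hn)
  calc (q x : Measure Y) (L j)ᶜ = (1 / 2) ^ j * (2 ^ j * (q x : Measure Y) (L j)ᶜ) := by
        rw [← mul_assoc, ← mul_pow, one_div, ENNReal.inv_mul_cancel (by simp) (by simp), one_pow,
          one_mul]
    _ ≤ (1 / 2) ^ j * n := by gcongr
    _ = ((n : ℝ≥0) : ℝ≥0∞) * (1 / 2) ^ j := by rw [mul_comm]; simp

end

/-! ### Monotonicity of optimal kernels -/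

section

variable {X Y : Type*} [TopologicalSpace X] [MeasurableSpace X] [BorelSpace X]
  [TopologicalSpace Y] [PolishSpace Y] [MeasurableSpace Y] [BorelSpace Y]
  {c : X → ProbabilityMeasure Y → ℝ≥0∞}

/-- Where `q` takes values in a compact tight family, the cost is the lower semicontinuous cube cost
evaluated at measurable moments; countably many such sets exhaust `μ`. -/
theorem aemeasurable_cost (hc : LowerSemicontinuous (Function.uncurry c)) (μ : Measure X)
    [IsFiniteMeasure μ] {q : X → ProbabilityMeasure Y}
    (hq : Measurable fun x => (q x : Measure Y)) : AEMeasurable (fun x => c x (q x)) μ := by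
  obtain ⟨f, hf⟩ := exists_isDetermining (Y := Y)
  obtain ⟨L, hL, hae⟩ := exists_ae_mem_tightFamily μ hq
  let K : ℕ → Set X := fun n => {x | q x ∈ tightFamily L n}
  have hK : ∀ n, MeasurableSet (K n) := fun n => measurableSet_preimage_tightFamily hL n hq
  have hu : μ.restrict (⋃ n, K n) = μ := by
    rw [Measure.restrict_eq_self_of_ae_mem]
    filter_upwards [hae] with x ⟨n₀, hn₀⟩
    exact mem_iUnion.2 ⟨n₀, hn₀ n₀ le_rfl⟩
  rw [← hu, aemeasurable_iUnion_iff]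
  intro n
  have hC : LowerSemicontinuous (Function.uncurry (cubeCost f (tightFamily L n) c)) :=
    lowerSemicontinuous_cubeCost (isCompact_tightFamily hL n) hc
  have hcube : IsCubeMap fun x => moment f (q x) :=
    ⟨measurable_moment f hq, fun x => hf.moment_mem (q x)⟩
  have hm := hcube.measurable_cost hC
  have hcongr : ∀ x ∈ K n, cubeCost f (tightFamily L n) c x (moment f (q x)) = c x (q x) :=
    fun x hx => hf.cubeCost_moment hx x
  exact hm.aemeasurable.congr ((ae_restrict_mem (hK n)).mono hcongr)

/-- Optimal kernels are monotone. -/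
theorem exists_monotone_set_of_optimal (hc : LowerSemicontinuous (Function.uncurry c))
    (hconv : IsConvexCost c) (μ : Measure X) [IsFiniteMeasure μ] {q₀ : X → ProbabilityMeasure Y}
    (hq₀ : Measurable fun x => (q₀ x : Measure Y)) (hfin : ∫⁻ x, c x (q₀ x) ∂μ ≠ ∞)
    (hopt : ∀ q : X → ProbabilityMeasure Y, Measurable (fun x => (q x : Measure Y)) →
      μ.bind (fun x => (q x : Measure Y)) = μ.bind (fun x => (q₀ x : Measure Y)) →
      ∫⁻ x, c x (q₀ x) ∂μ ≤ ∫⁻ x, c x (q x) ∂μ) :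
    ∃ Γ : Set X, MeasurableSet Γ ∧ μ Γᶜ = 0 ∧ ∀ (N : ℕ) (x : Fin N → X), (∀ i, x i ∈ Γ) →
      ∀ m : Fin N → ProbabilityMeasure Y,
        ∑ i, (m i : Measure Y) = ∑ i, (q₀ (x i) : Measure Y) →
        ∑ i, c (x i) (q₀ (x i)) ≤ ∑ i, c (x i) (m i) := by
  obtain ⟨f, hf⟩ := exists_isDetermining (Y := Y)
  obtain ⟨L, hL, hae⟩ := exists_ae_mem_tightFamily μ hq₀
  let K : ℕ → Set X := fun n => {x | q₀ x ∈ tightFamily L n}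
  have hK : ∀ n, MeasurableSet (K n) := fun n => measurableSet_preimage_tightFamily hL n hq₀
  choose Γ hΓK hΓ hΓ0 hmono using fun n : ℕ =>
    exists_monotone_set_of_isCompact hf hc hconv μ hq₀ hfin hopt
      -- The term `n * n` accommodates competitors for up to `n` points; the extra `n` makes it
      -- evident that `q₀ x` belongs to the family.
      (isCompact_tightFamily hL ((n : ℝ≥0) * n + n))
      (isConvexFamily_tightFamily L ((n : ℝ≥0) * n + n))
      (hK n) fun x hx => by
        have hx' := mem_tightFamily.1 hx
        refine mem_tightFamily.2 fun j => (hx' j).trans ?_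
        gcongr
        exact le_add_self
  -- A lower limit of sets, since finitely many points must share a `Γ n` with `n ≥ N`.
  refine ⟨⋃ n₀, ⋂ n ≥ n₀, Γ n, MeasurableSet.iUnion fun n₀ => MeasurableSet.biInter
    (Set.to_countable _) fun n _ => hΓ n, ?_, fun N x hx m hsum => ?_⟩
  · have h1 : ∀ᵐ x ∂μ, ∀ n, x ∈ K n → x ∈ Γ n := by
      refine ae_all_iff.2 fun n => ?_
      rw [ae_iff]
      refine measure_mono_null (fun x hx => ?_) (hΓ0 n)
      exact Classical.not_imp.1 hx
    change ∀ᵐ x ∂μ, x ∈ ⋃ n₀, ⋂ n ≥ n₀, Γ n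
    filter_upwards [hae, h1] with x ⟨n₀, hn₀⟩ hx
    exact mem_iUnion.2 ⟨n₀, mem_iInter₂.2 fun n hn => hx n (hn₀ n hn)⟩
  · simp only [mem_iUnion, mem_iInter] at hx
    choose n₀ hn₀ using hx
    let n : ℕ := max N (Finset.univ.sup n₀)
    have hxn : ∀ i, x i ∈ Γ n := fun i =>
      hn₀ i n ((Finset.le_sup (Finset.mem_univ i)).trans (le_max_right _ _))
    refine hmono n N x hxn m (fun i => mem_tightFamily.2 fun j => ?_) hsum
    calc (m i : Measure Y) (L j)ᶜ ≤ ∑ i, (m i : Measure Y) (L j)ᶜ :=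
          Finset.single_le_sum (f := fun i => (m i : Measure Y) (L j)ᶜ)
            (fun _ _ => zero_le) (Finset.mem_univ i)
      _ = (∑ i, (m i : Measure Y)) (L j)ᶜ := by rw [Measure.finsetSum_apply]
      _ = ∑ i, (q₀ (x i) : Measure Y) (L j)ᶜ := by rw [hsum, Measure.finsetSum_apply]
      _ ≤ ∑ _i : Fin N, ((n : ℝ≥0) : ℝ≥0∞) * (1 / 2) ^ j :=
          Finset.sum_le_sum fun i _ => mem_tightFamily.1 (hΓK n (hxn i)) j
      _ = (N : ℝ≥0∞) * (((n : ℝ≥0) : ℝ≥0∞) * (1 / 2) ^ j) := by simp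
      _ ≤ (n : ℝ≥0∞) * (((n : ℝ≥0) : ℝ≥0∞) * (1 / 2) ^ j) := by
          gcongr
          exact le_max_left _ _
      _ = (((n : ℝ≥0) * n : ℝ≥0) : ℝ≥0∞) * (1 / 2) ^ j := by push_cast; rw [mul_assoc]
      _ ≤ (((n : ℝ≥0) * n + n : ℝ≥0) : ℝ≥0∞) * (1 / 2) ^ j := by
          gcongr
          exact le_self_add

end

/-! ### Extended real arithmetic and reduction to nonnegative costs -/

section

variable {X : Type*} [MeasurableSpace X]

theorem eintegral_congr_ae {f g : X → EReal} {μ : Measure X} (h : f =ᵐ[μ] g) :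
    eintegral f μ = eintegral g μ := by
  have h1 : ∫⁻ x, (f x).toENNReal ∂μ = ∫⁻ x, (g x).toENNReal ∂μ :=
    lintegral_congr_ae (h.mono fun x hx => congrArg EReal.toENNReal hx)
  have h2 : ∫⁻ x, (-f x).toENNReal ∂μ = ∫⁻ x, (-g x).toENNReal ∂μ :=
    lintegral_congr_ae (h.mono fun x hx => congrArg (fun e : EReal => (-e).toENNReal) hx)
  rw [eintegral, eintegral, h1, h2]

theorem coe_sub_coe_eq_of_add_eq {a d i e : ℝ≥0∞} (hd : d ≠ ∞) (he : e ≠ ∞)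
    (h : a + e = i + d) : (a : EReal) - d = i - e := by
  lift d to ℝ≥0 using hd
  lift e to ℝ≥0 using he
  induction a with
  | top =>
    have hi : i = ∞ := by
      by_contra hi
      exact ENNReal.add_ne_top.2 ⟨hi, ENNReal.coe_ne_top⟩ (by rw [← h, top_add])
    subst hi
    simp [EReal.coe_nnreal_eq_coe_real]
  | coe a =>
    have hi : i ≠ ∞ := fun hi => by
      rw [hi, top_add] at h
      exact ENNReal.add_ne_top.2 ⟨ENNReal.coe_ne_top, ENNReal.coe_ne_top⟩ h
    lift i to ℝ≥0 using hi
    have h' : (a : ℝ) + e = i + d := by exact_mod_cast h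
    have h2 : (a : ℝ) - d = i - e := by linarith
    simp only [EReal.coe_nnreal_eq_coe_real]
    exact_mod_cast h2

/-- The extended integral of a function bounded from below by `-β`. -/
theorem eintegral_coe_sub {h : X → ℝ≥0∞} {μ : Measure X} [IsFiniteMeasure μ]
    (hh : AEMeasurable h μ) (β : ℝ≥0) :
    eintegral (fun x => (h x : EReal) - ((β : ℝ≥0∞) : EReal)) μ =
      ((∫⁻ x, h x ∂μ : ℝ≥0∞) : EReal) - ((β * μ univ : ℝ≥0∞) : EReal) := by
  have h1 : ∀ x, ((h x : EReal) - ((β : ℝ≥0∞) : EReal)).toENNReal = h x - β := fun x => by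
    rw [EReal.toENNReal_sub (EReal.coe_ennreal_nonneg _), EReal.toENNReal_coe,
      EReal.toENNReal_coe]
  have h2 : ∀ x, (-((h x : EReal) - ((β : ℝ≥0∞) : EReal))).toENNReal = β - h x := fun x => by
    rw [EReal.neg_sub (Or.inr (by simp)) (Or.inr (by simp)), add_comm, ← sub_eq_add_neg,
      EReal.toENNReal_sub (EReal.coe_ennreal_nonneg _), EReal.toENNReal_coe,
      EReal.toENNReal_coe]
  unfold eintegral
  simp only [h1, h2]
  have hE : (β : ℝ≥0∞) * μ univ ≠ ∞ := ENNReal.mul_ne_top ENNReal.coe_ne_top (measure_ne_top _ _)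
  -- Integrates `(h - β)⁺ + β = h + (β - h)⁺`.
  refine coe_sub_coe_eq_of_add_eq ?_ hE ?_
  · refine ne_top_of_le_ne_top hE ?_
    rw [← lintegral_const]
    exact lintegral_mono fun x => tsub_le_self
  · rw [← lintegral_const, ← lintegral_add_right _ measurable_const, ← lintegral_add_left' hh]
    refine lintegral_congr fun x => ?_
    rcases le_total (h x) β with hx | hx
    · rw [tsub_eq_zero_of_le hx, zero_add, add_tsub_cancel_of_le hx]
    · rw [tsub_eq_zero_of_le hx, add_zero, tsub_add_cancel_of_le hx]

end

/-- A finite total energy forces the entropies `e₁`, `e₂` and the integral `i` to be finite, after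
which common terms cancel. -/
theorem ne_top_and_le_of_add_sub_le_add_sub {e₁ e₂ i j m : ℝ≥0∞} (hm : m ≠ ∞)
    (hfin : (e₁ : EReal) + e₂ + (i - m) < ⊤)
    (hle : (e₁ : EReal) + e₂ + (i - m) ≤ e₁ + e₂ + (j - m)) : i ≠ ∞ ∧ i ≤ j := by
  lift m to ℝ≥0 using hm
  have hsub : ∀ k : ℝ≥0∞, (k : EReal) - ((m : ℝ≥0∞) : EReal) ≠ ⊥ := fun k => by
    rw [sub_eq_add_neg, EReal.add_ne_bot_iff]
    simp
  have h1 : e₁ ≠ ∞ := by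
    rintro rfl
    rw [EReal.coe_ennreal_top, EReal.top_add_of_ne_bot (by simp),
      EReal.top_add_of_ne_bot (hsub i)] at hfin
    exact lt_irrefl _ hfin
  have h2 : e₂ ≠ ∞ := by
    rintro rfl
    rw [EReal.coe_ennreal_top, EReal.add_top_of_ne_bot (by simp),
      EReal.top_add_of_ne_bot (hsub i)] at hfin
    exact lt_irrefl _ hfin
  lift e₁ to ℝ≥0 using h1
  lift e₂ to ℝ≥0 using h2
  have hi : i ≠ ∞ := by
    rintro rfl
    have : ((∞ : ℝ≥0∞) : EReal) - ((m : ℝ≥0∞) : EReal) = ⊤ := rfl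
    rw [this, EReal.add_top_of_ne_bot (by
      rw [EReal.add_ne_bot_iff]
      simp)] at hfin
    exact lt_irrefl _ hfin
  refine ⟨hi, ?_⟩
  by_cases hj : j = ∞
  · rw [hj]
    exact le_top
  lift i to ℝ≥0 using hi
  lift j to ℝ≥0 using hj
  have h3 : (e₁ : ℝ) + e₂ + (i - m) ≤ e₁ + e₂ + (j - m) := by
    simp only [EReal.coe_nnreal_eq_coe_real] at hle
    exact_mod_cast hle
  have h4 : (i : ℝ) ≤ j := by linarith
  exact_mod_cast h4

theorem coe_finset_sum {ι : Type*} (s : Finset ι) (u : ι → ℝ≥0∞) :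
    ((∑ i ∈ s, u i : ℝ≥0∞) : EReal) = ∑ i ∈ s, (u i : EReal) := by
  classical
  induction s using Finset.induction_on with
  | empty => simp
  | insert a s ha ih => rw [Finset.sum_insert ha, Finset.sum_insert ha, EReal.coe_ennreal_add, ih]

/-- A weak cost is, up to an additive constant, a cost with values in `[0,∞]`. -/
theorem IsWeakCost.exists_nonneg {X₁ X₂ : Type*} [TopologicalSpace X₁] [TopologicalSpace X₂]
    [MeasurableSpace X₂] [BorelSpace X₂] {C : X₁ → ProbabilityMeasure X₂ → EReal} (hC : IsWeakCost C) :
    ∃ (β : ℝ≥0) (c : X₁ → ProbabilityMeasure X₂ → ℝ≥0∞),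
      LowerSemicontinuous (Function.uncurry c) ∧ IsConvexCost c ∧
      ∀ x p, C x p = (c x p : EReal) - ((β : ℝ≥0∞) : EReal) := by
  obtain ⟨b, hb⟩ := hC.bddBelow
  let β : ℝ≥0 := (-b).toNNReal
  have hβ : ∀ x p, 0 ≤ C x p + ((β : ℝ) : EReal) := fun x p => by
    have h1 : (0 : ℝ) ≤ b + β := by
      have := Real.le_coe_toNNReal (-b)
      simp only [β]
      linarith
    calc (0 : EReal) ≤ ((b + β : ℝ) : EReal) := by exact_mod_cast h1
      _ = b + ((β : ℝ) : EReal) := EReal.coe_add _ _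
      _ ≤ C x p + ((β : ℝ) : EReal) := by gcongr; exact hb x p
  have hcoe : ∀ x p, ((C x p + ((β : ℝ) : EReal)).toENNReal : EReal) = C x p + ((β : ℝ) : EReal) :=
    fun x p => EReal.coe_toENNReal (hβ x p)
  refine ⟨β, fun x p => (C x p + ((β : ℝ) : EReal)).toENNReal, ?_, ?_, fun x p => ?_⟩
  · have hcont : Continuous fun e : EReal => (e + ((β : ℝ) : EReal)).toENNReal := by
      refine EReal.continuous_toENNReal.comp (continuous_iff_continuousAt.2 fun e => ?_)
      exact (EReal.continuousAt_add (p := (e, ((β : ℝ) : EReal))) (Or.inr (by simp))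
        (Or.inr (by simp))).comp (f := fun e : EReal => (e, ((β : ℝ) : EReal))) (by fun_prop)
    exact hcont.comp_lowerSemicontinuous hC.lsc fun e e' he =>
      EReal.toENNReal_le_toENNReal (by gcongr)
  · intro x s t hst p q r hr
    rw [← EReal.coe_ennreal_le_coe_ennreal_iff]
    have hst' : (s : ℝ) + t = 1 := by exact_mod_cast hst
    simp only [EReal.coe_ennreal_add, EReal.coe_ennreal_mul, hcoe]
    have hs : (((s : ℝ≥0∞)) : EReal) = ((s : ℝ) : EReal) := rfl
    have ht : (((t : ℝ≥0∞)) : EReal) = ((t : ℝ) : EReal) := rfl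
    have hs0 : (0 : EReal) ≤ ((s : ℝ) : EReal) := by exact_mod_cast s.2
    have ht0 : (0 : EReal) ≤ ((t : ℝ) : EReal) := by exact_mod_cast t.2
    rw [hs, ht, EReal.left_distrib_of_nonneg_of_ne_top hs0 (EReal.coe_ne_top _),
      EReal.left_distrib_of_nonneg_of_ne_top ht0 (EReal.coe_ne_top _), add_add_add_comm]
    have h3 : ((s : ℝ) : EReal) * ((β : ℝ) : EReal) + ((t : ℝ) : EReal) * ((β : ℝ) : EReal) =
        ((β : ℝ) : EReal) := by
      rw [← EReal.coe_mul, ← EReal.coe_mul, ← EReal.coe_add, ← add_mul, hst', one_mul]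
    rw [h3]
    gcongr
    exact hC.convex x s t hst p q r hr
  · rw [hcoe]
    have : (((β : ℝ≥0∞)) : EReal) = ((β : ℝ) : EReal) := rfl
    rw [this, EReal.add_sub_cancel_right]

theorem eintegral_cost {X₁ X₂ : Type*} [TopologicalSpace X₁] [MeasurableSpace X₁] [BorelSpace X₁]
    [TopologicalSpace X₂] [PolishSpace X₂] [MeasurableSpace X₂] [BorelSpace X₂]
    {C : X₁ → ProbabilityMeasure X₂ → EReal} (β : ℝ≥0) {c : X₁ → ProbabilityMeasure X₂ → ℝ≥0∞}
    (hc : LowerSemicontinuous (Function.uncurry c))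
    (hCc : ∀ x p, C x p = (c x p : EReal) - ((β : ℝ≥0∞) : EReal))
    {μ : Measure X₁} [IsFiniteMeasure μ] {q : X₁ → ProbabilityMeasure X₂}
    (hq : Measurable fun x => (q x : Measure X₂)) :
    eintegral (fun x => C x (q x)) μ =
      ((∫⁻ x, c x (q x) ∂μ : ℝ≥0∞) : EReal) - ((β * μ univ : ℝ≥0∞) : EReal) := by
  simp only [hCc]
  exact eintegral_coe_sub (aemeasurable_cost hc μ hq) β

/-! ### Plans and disintegrations -/

section

variable {X₁ X₂ : Type*} [MeasurableSpace X₁]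
  [TopologicalSpace X₂] [PolishSpace X₂] [MeasurableSpace X₂] [BorelSpace X₂] [Nonempty X₂]

theorem measurable_disint (γ : FiniteMeasure (X₁ × X₂)) :
    Measurable fun x => (disint γ x : Measure X₂) :=
  (γ : Measure (X₁ × X₂)).condKernel.measurable

theorem bind_disint (γ : FiniteMeasure (X₁ × X₂)) :
    (γ : Measure (X₁ × X₂)).fst.bind (fun x => (disint γ x : Measure X₂)) =
      (γ : Measure (X₁ × X₂)).snd := by
  conv_rhs => rw [← (γ : Measure (X₁ × X₂)).disintegrate (γ : Measure (X₁ × X₂)).condKernel]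
  rw [Measure.snd_compProd]
  rfl

/-- The plan with a given first marginal and a given disintegration. -/
theorem exists_plan (μ : Measure X₁) [IsFiniteMeasure μ] {q : X₁ → ProbabilityMeasure X₂}
    (hq : Measurable fun x => (q x : Measure X₂)) :
    ∃ γ : FiniteMeasure (X₁ × X₂), (γ : Measure (X₁ × X₂)).fst = μ ∧
      (γ : Measure (X₁ × X₂)).snd = μ.bind (fun x => (q x : Measure X₂)) ∧
      ∀ᵐ x ∂μ, disint γ x = q x := by
  let κ : Kernel X₁ X₂ := ⟨fun x => (q x : Measure X₂), hq⟩
  have hκ : IsMarkovKernel κ := ⟨fun x => inferInstanceAs (IsProbabilityMeasure (q x : Measure X₂))⟩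
  have hfst : (μ.compProd κ).fst = μ := Measure.fst_compProd μ κ
  refine ⟨⟨μ.compProd κ, inferInstance⟩, hfst, Measure.snd_compProd μ κ, ?_⟩
  have h := eq_condKernel_of_measure_eq_compProd (ρ := μ.compProd κ) κ (by rw [hfst])
  rw [hfst] at h
  filter_upwards [h] with x hx
  exact Subtype.ext hx.symm

end

end WOET

/-! ### The main theorem -/

theorem mainTheorem5 {X₁ X₂ : Type*}
    [TopologicalSpace X₁] [PolishSpace X₁] [MeasurableSpace X₁] [BorelSpace X₁]
    [TopologicalSpace X₂] [PolishSpace X₂] [MeasurableSpace X₂] [BorelSpace X₂] [Nonempty X₂]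
    (F₁ F₂ : ℝ≥0 → ℝ≥0∞) (hF₁ : WOET.IsAdmissible F₁) (hF₂ : WOET.IsAdmissible F₂)
    (C : X₁ → ProbabilityMeasure X₂ → EReal) (hC : WOET.IsWeakCost C)
    (μ₁ : FiniteMeasure X₁) (μ₂ : FiniteMeasure X₂)
    (hfeas : WOET.IsFeasible F₁ F₂ C μ₁ μ₂) (hcoer : WOET.IsCoercive F₁ F₂ C)
    (γ : FiniteMeasure (X₁ × X₂)) (hγ : WOET.IsOptimalPlan F₁ F₂ C μ₁ μ₂ γ) :
    WOET.IsCMonotone C γ := by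
  obtain ⟨β, c, hc, hconv, hCc⟩ := hC.exists_nonneg
  set μ : Measure X₁ := (γ : Measure (X₁ × X₂)).fst with hμ
  have hmass : (β : ℝ≥0∞) * μ Set.univ ≠ ∞ :=
    ENNReal.mul_ne_top ENNReal.coe_ne_top (measure_ne_top _ _)
  have hle : ∀ γ' : FiniteMeasure (X₁ × X₂),
      WOET.energy F₁ F₂ C μ₁ μ₂ γ ≤ WOET.energy F₁ F₂ C μ₁ μ₂ γ' := fun γ' =>
    hγ.trans_le (iInf_le _ γ')
  have hlt : WOET.energy F₁ F₂ C μ₁ μ₂ γ < ⊤ := by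
    obtain ⟨γ', hγ'⟩ := hfeas
    exact (hle γ').trans_lt hγ'
  have hE := WOET.eintegral_cost β hc hCc (μ := μ) (WOET.measurable_disint γ)
  -- A kernel with the same second marginal defines a plan with both marginals of `γ`; only the cost
  -- integral can differ.
  have hcomp : ∀ q : X₁ → ProbabilityMeasure X₂, Measurable (fun x => (q x : Measure X₂)) →
      μ.bind (fun x => (q x : Measure X₂)) =
        μ.bind (fun x => (WOET.disint γ x : Measure X₂)) →
      ∫⁻ x, c x (WOET.disint γ x) ∂μ ≠ ∞ ∧
        ∫⁻ x, c x (WOET.disint γ x) ∂μ ≤ ∫⁻ x, c x (q x) ∂μ := by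
    intro q hq hbind
    obtain ⟨γ', hfst, hsnd, hdis⟩ := WOET.exists_plan μ hq
    have hE' : WOET.eintegral (fun x => C x (WOET.disint γ' x)) μ = _ :=
      (WOET.eintegral_congr_ae (hdis.mono fun x hx => by simp only [hx])).trans
        (WOET.eintegral_cost β hc hCc (μ := μ) hq)
    have h1 := hle γ'
    have h2 := hlt
    unfold WOET.energy at h1 h2
    rw [hfst, hsnd, hbind, WOET.bind_disint, hE', ← hμ, hE] at h1
    rw [← hμ, hE] at h2
    exact WOET.ne_top_and_le_of_add_sub_le_add_sub hmass h2 h1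
  obtain ⟨Γ, hΓ, hΓ0, hmono⟩ := WOET.exists_monotone_set_of_optimal hc hconv μ
    (WOET.measurable_disint γ) (hcomp _ (WOET.measurable_disint γ) rfl).1
    fun q hq hbind => (hcomp q hq hbind).2
  refine ⟨Γ, hΓ, hΓ0, fun N x hx m hsum => ?_⟩
  simp only [hCc, sub_eq_add_neg, Finset.sum_add_distrib]
  rw [← WOET.coe_finset_sum, ← WOET.coe_finset_sum]
  gcongr
  exact EReal.coe_ennreal_le_coe_ennreal_iff.2 (hmono N x hx m hsum)
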